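/- Let $\phi(y)=\sum_{k\ge 0}\phi_k y^k$ be a power series with nonnegative real coefficients and radius of convergence $R\in(0,\infty]$, such that $\phi_0\neq 0$, such that $\phi_k\ne 0$ for some $k\ge 2$, and such that $\phi$ is aperiodic, i.e. the integer combinations of the exponents $k$ with $\phi_k\neq 0$ are all of $\mathbb{Z}$. Let $f$ be the (unique) formal power series satisfying $f(z)=z\,\phi(f(z))$; its coefficients are nonnegative. Let $y_0\in(0,R)$ be the positive solution of $y\,\phi'(y)=\phi(y)$ (assumed to exist), and let $\psi$ be a power series with complex coefficients whose radius of convergence is strictly greater than $y_0$. Then there are complex numbers $b_0,b_1,b_2,\dots$ such that, as $n\to\infty$, $$[z^n]\,\psi(f(z)) \sim \phi'(y_0)^n\, n^{-3/2}\sum_{k\ge 0} b_k n^{-k}$$ as an asymptotic expansion, meaning that for every $N\ge 0$ $$[z^n]\,\psi(f(z)) = \phi'(y_0)^n\, n^{-3/2}\Bigl(\sum_{k=0}^{N-1} b_k n^{-k} + O(n^{-N})\Bigr),$$ and $$b_0=\frac{\psi'(y_0)}{\sqrt{2\pi\,\phi''(y_0)/\phi(y_0)}}.$$ -/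

import Mathlib

open Filter Asymptotics PowerSeries
open scoped ENNReal

/-- The radius of convergence of a power series in one variable. -/
noncomputable def seriesRadius {𝕜 : Type*} [RCLike 𝕜] (p : PowerSeries 𝕜) : ℝ≥0∞ :=
  (FormalMultilinearSeries.ofScalars 𝕜 (fun n => coeff n p)).radius

/-- The function `x ↦ ∑ pₙ xⁿ` (meaningful inside the disc of convergence). -/
noncomputable def seriesFun {𝕜 : Type*} [RCLike 𝕜] (p : PowerSeries 𝕜) (x : 𝕜) : 𝕜 :=
  ∑' n : ℕ, coeff n p * x ^ n

/-- A power series is aperiodic if the integer combinations of the exponents of its monomials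
are all of `ℤ`. -/
def IsAperiodicSeries {R : Type*} [Semiring R] (p : PowerSeries R) : Prop :=
  AddSubgroup.closure {m : ℤ | ∃ k : ℕ, coeff k p ≠ 0 ∧ m = (k : ℤ)} = ⊤

/-- `a n ∼ g n * ∑ₖ bₖ n⁻ᵏ` as an asymptotic expansion for `n → ∞`: for every `N`, the error
after the terms `k < N` is `O(g n * n⁻ᴺ)`. -/
def HasAsymptoticSeries (a : ℕ → ℂ) (g : ℕ → ℝ) (b : ℕ → ℂ) : Prop :=
  ∀ N : ℕ,
    (fun n : ℕ => a n - (g n : ℂ) * ∑ k ∈ Finset.range N, b k * ((n : ℂ) ^ k)⁻¹)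
      =O[atTop] (fun n : ℕ => g n * ((n : ℝ) ^ N)⁻¹)

/-! Lagrange inversion (`lagrange_inversion`) gives n [zⁿ] ψ(f) = [yⁿ⁻¹] ψ'(y) φ(y)ⁿ, so no
singularity analysis of f is needed. Cauchy's formula on the circle of radius y₀
(`integral_saddle_eq_coeff`) turns this into ∫ G Hⁿ over [-π, π], where G(θ) = y₀ e^{iθ} ψ'(y₀
e^{iθ}) and H(θ) = φ(y₀ e^{iθ}) e^{-iθ} / φ(y₀), with prefactor (φ(y₀)/y₀)ⁿ / (2πn) and φ(y₀)/y₀ =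
φ'(y₀).

The equation for y₀ says H'(0) = 0, and H''(0) = -v with v = y₀² φ''(y₀)/φ(y₀) > 0. Aperiodicity
forces |H| < 1 at every other angle (`IsAperiodicSeries.norm_seriesFun_exp_lt`), so only a
neighbourhood of 0 matters up to exponentially small errors.

Near 0, H = exp(-w²/2) with w holomorphic and w'(0) = √v (`exists_isLaplacePhase`). Split G = a w' +
w w' q. The first part integrates to a √(2π/n) up to an exponentially small error; integrating the
second by parts gives 1/n times the same kind of integral with q' in place of G, up to exponentially
small boundary terms (`exists_laplaceIntegral_step`). Iteration yields the full expansion in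
n^{-1/2-k}; the 1/n from Lagrange inversion makes it n^{-3/2-k}. -/

/-! ### Formal Lagrange inversion. -/

section FormalLagrange

variable {K : Type*} [Field K]

/-- The only contribution to the coefficient of the transformed form is the residue. -/
theorem coeff_pow_mul_derivative_mul_inv [CharZero K] (φ : PowerSeries K)
    (hφ : constantCoeff φ ≠ 0) {n j : ℕ} (hj : j ≤ n) :
    coeff n ((X * φ⁻¹) ^ j * derivative K (X * φ⁻¹) * φ ^ (n + 1)) = if j = n then 1 else 0 := by
  obtain ⟨m, rfl⟩ := Nat.exists_eq_add_of_le hj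
  have hinv : φ⁻¹ * φ = 1 := PowerSeries.inv_mul_cancel φ hφ
  have e1 : (X * φ⁻¹) ^ j * derivative K (X * φ⁻¹) * φ ^ (j + m + 1)
      = X ^ j * (φ ^ m * (1 - X * φ⁻¹ * derivative K φ)) := by
    have h2 : derivative K (X * φ⁻¹) * φ = 1 - X * φ⁻¹ * derivative K φ := by
      rw [Derivation.leibniz, derivative_inv', derivative_X]
      simp only [smul_eq_mul]
      linear_combination (1 - X * φ⁻¹ * derivative K φ) * hinv
    have h3 : (X * φ⁻¹) ^ j * φ ^ j = X ^ j := by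
      rw [← mul_pow, mul_assoc, hinv, mul_one]
    calc _ = ((X * φ⁻¹) ^ j * φ ^ j) * φ ^ m * (derivative K (X * φ⁻¹) * φ) := by ring
      _ = _ := by rw [h2, h3]; ring
  rw [e1, add_comm j m, coeff_X_pow_mul]
  rcases m with _ | m
  · simp [mul_assoc]
  · have e2 : φ ^ (m + 1) * (1 - X * φ⁻¹ * derivative K φ)
        = φ ^ (m + 1) - X * (φ ^ m * derivative K φ) := by
      linear_combination (-(φ ^ m * X * derivative K φ)) * hinv
    -- Since (m+1) φ^m φ' is the derivative of φ^(m+1), the two terms in `e2` have equal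
    -- coefficients at m+1 and cancel. Characteristic zero permits the division by m+1.
    have h4 : ((m : K) + 1) * coeff m (φ ^ m * derivative K φ)
        = coeff (m + 1) (φ ^ (m + 1)) * ((m : K) + 1) := by
      rw [← coeff_derivative, derivative_pow]
      have : ((m + 1 : ℕ) : PowerSeries K) = C ((m : K) + 1) := by simp
      rw [this, Nat.add_sub_cancel, mul_assoc, coeff_C_mul]
    have h5 : (m : K) + 1 ≠ 0 := by exact_mod_cast Nat.succ_ne_zero m
    rw [e2, map_sub, coeff_succ_X_mul, if_neg (by omega)]
    refine (mul_right_inj' h5).1 ?_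
    rw [mul_sub, h4]; ring

theorem subst_div_eq_X_of_eq_X_mul_subst {φ f : PowerSeries K} (hφ : constantCoeff φ ≠ 0)
    (hf : f = X * φ.subst f) : (X * φ⁻¹).subst f = X := by
  have hs : HasSubst f := HasSubst.of_constantCoeff_zero' (by rw [hf]; simp)
  have h1 : (φ⁻¹).subst f * φ.subst f = 1 := by
    rw [← subst_mul hs, PowerSeries.inv_mul_cancel φ hφ, ← map_one C, subst_C]
    simp
  rw [subst_mul hs, subst_X hs]
  nth_rewrite 1 [hf]
  linear_combination X * h1

/-- The series X φ⁻¹ has an invertible linear coefficient, hence a compositional inverse; by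
associativity f, an inverse on one side, must be that inverse. -/
theorem subst_eq_X_of_eq_X_mul_subst {φ f : PowerSeries K} (hφ : constantCoeff φ ≠ 0)
    (hf : f = X * φ.subst f) : f.subst (X * φ⁻¹) = X := by
  set g : PowerSeries K := X * φ⁻¹ with hg
  have hs : HasSubst f := HasSubst.of_constantCoeff_zero' (by rw [hf]; simp)
  have hsg : HasSubst g := HasSubst.of_constantCoeff_zero' (by simp [hg])
  have hgf := subst_div_eq_X_of_eq_X_mul_subst hφ hf
  have hg1 : IsUnit (coeff 1 g) := by
    have : coeff 1 g = (constantCoeff φ)⁻¹ := by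
      rw [hg, show 1 = 0 + 1 from rfl, coeff_succ_X_mul]; simp
    rw [this]; exact (inv_ne_zero hφ).isUnit
  have hg0 : constantCoeff g = 0 := by simp [hg]
  have hl := subst_substInvOfIsUnit_left g hg0 hg1
  have key : (g.substInvOfIsUnit hg1) = f := by
    have := subst_comp_subst_apply hsg hs (g.substInvOfIsUnit hg1)
    rw [hl, hgf, subst_X hs, X_subst] at this
    exact this.symm
  rw [← key]; exact hl

/-- **Lagrange inversion**, in the form with a test series `ψ`. -/
theorem lagrange_inversion [CharZero K] {φ f : PowerSeries K} (hφ : constantCoeff φ ≠ 0)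
    (hf : f = X * φ.subst f) (ψ : PowerSeries K) (n : ℕ) :
    ((n : K) + 1) * coeff (n + 1) (ψ.subst f) = coeff n (derivative K ψ * φ ^ (n + 1)) := by
  set g : PowerSeries K := X * φ⁻¹ with hg
  have hs : HasSubst f := HasSubst.of_constantCoeff_zero' (by rw [hf]; simp)
  have hsg : HasSubst g := HasSubst.of_constantCoeff_zero' (by simp [hg])
  set A := ψ.subst f with hA
  -- With ψ = A(g), the right-hand side becomes the coefficient of A'(g) g' φ^(n+1), which the
  -- residue computation evaluates power by power.
  have hψ : ψ = PowerSeries.subst g A := by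
    rw [hA, subst_comp_subst_apply hs hsg, subst_eq_X_of_eq_X_mul_subst hφ hf, X_subst]
  have hB : coeff n (derivative K A) = ((n : K) + 1) * coeff (n + 1) A := by
    rw [coeff_derivative, mul_comm]
  rw [← hB, hψ, derivative_subst hsg]
  set B := derivative K A
  -- As g^(n+1) is divisible by X^(n+1), only the powers g^j with j ≤ n reach the coefficient n;
  -- cutting B there leaves a finite sum.
  have hdec := eq_X_pow_mul_shift_add_trunc (n + 1) B
  set D : PowerSeries K := mk fun i => coeff (i + (n + 1)) B
  have hBs : B.subst g = g ^ (n + 1) * D.subst g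
      + ∑ j ∈ Finset.range (n + 1), C (coeff j B) * g ^ j := by
    conv_lhs => rw [hdec]
    rw [subst_add hsg, subst_mul hsg, subst_pow hsg, subst_X hsg, subst_coe hsg]
    congr 1
    rw [Polynomial.aeval_eq_sum_range' (n := n + 1)]
    · refine Finset.sum_congr rfl fun j hj => ?_
      rw [coeff_trunc, if_pos (Finset.mem_range.1 hj), smul_eq_C_mul]
    · exact natDegree_trunc_lt _ _
  rw [hBs, add_mul, add_mul, map_add, Finset.sum_mul, Finset.sum_mul, map_sum]
  have h0 : coeff n (g ^ (n + 1) * D.subst g * derivative K g * φ ^ (n + 1)) = 0 := by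
    have : g ^ (n + 1) * D.subst g * derivative K g * φ ^ (n + 1)
        = X ^ (n + 1) * (φ⁻¹ ^ (n + 1) * D.subst g * derivative K g * φ ^ (n + 1)) := by
      rw [hg]; ring
    rw [this, coeff_X_pow_mul', if_neg (by omega)]
  rw [h0, zero_add, Finset.sum_eq_single n]
  · rw [mul_assoc, mul_assoc, coeff_C_mul, ← mul_assoc,
      coeff_pow_mul_derivative_mul_inv φ hφ le_rfl]
    simp
  · intro j hj hjn
    rw [mul_assoc, mul_assoc, coeff_C_mul, ← mul_assoc,
      coeff_pow_mul_derivative_mul_inv φ hφ (Nat.lt_succ_iff.1 (Finset.mem_range.1 hj)),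
      if_neg hjn, mul_zero]
  · simp

end FormalLagrange

/-! ### Absolutely convergent power series as functions, and Cauchy's formula. -/

section SeriesAnalysis

variable {𝕜 : Type*} [RCLike 𝕜]

/-- The power series `p` converges absolutely at the points of modulus `r`. -/
def AbsSummableAt (p : PowerSeries 𝕜) (r : ℝ) : Prop :=
  Summable fun n => ‖coeff n p‖ * r ^ n

theorem exists_absSummableAt_of_lt_seriesRadius {p : PowerSeries 𝕜} {r : ℝ} (hr : 0 ≤ r)
    (h : ENNReal.ofReal r < seriesRadius p) : ∃ R, r < R ∧ AbsSummableAt p R := by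
  obtain ⟨R, h1, h2⟩ := ENNReal.lt_iff_exists_nnreal_btwn.1 h
  refine ⟨R, ?_, ?_⟩
  · rw [ENNReal.ofReal_lt_iff_lt_toReal hr ENNReal.coe_ne_top] at h1
    simpa using h1
  · have := FormalMultilinearSeries.summable_norm_mul_pow _ h2
    simpa [AbsSummableAt, FormalMultilinearSeries.ofScalars_norm] using this

namespace AbsSummableAt

variable {p q : PowerSeries 𝕜} {r R : ℝ} {x : 𝕜}

theorem mono (h : AbsSummableAt p R) (hr : 0 ≤ r) (hrR : r ≤ R) : AbsSummableAt p r :=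
  Summable.of_nonneg_of_le (fun n => by positivity) (fun n => by gcongr) h

theorem summable_norm (h : AbsSummableAt p r) (hx : ‖x‖ ≤ r) :
    Summable fun n => ‖coeff n p * x ^ n‖ := by
  refine Summable.of_nonneg_of_le (fun n => norm_nonneg _) (fun n => ?_) h
  rw [norm_mul, norm_pow]; gcongr

theorem summable (h : AbsSummableAt p r) (hx : ‖x‖ ≤ r) :
    Summable fun n => coeff n p * x ^ n :=
  (h.summable_norm hx).of_norm

/-- Absorbs the factor n+1 created by differentiation into the gap between r and R. -/
theorem _root_.succ_mul_pow_mul_sub_le (hr : 0 ≤ r) (h : r ≤ R) (n : ℕ) :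
    ((n : ℝ) + 1) * r ^ n * (R - r) ≤ R ^ (n + 1) := by
  induction n with
  | zero => simpa using hr
  | succ n ih =>
    have h1 : r ^ (n + 1) ≤ R ^ (n + 1) := by gcongr
    have h2 := mul_le_mul_of_nonneg_left ih hr
    have h3 := mul_le_mul_of_nonneg_right h1 (sub_nonneg.2 h)
    push_cast
    calc _ = r * (((n : ℝ) + 1) * r ^ n * (R - r)) + r ^ (n + 1) * (R - r) := by ring
      _ ≤ r * R ^ (n + 1) + R ^ (n + 1) * (R - r) := add_le_add h2 h3
      _ = _ := by ring

theorem derivative (h : AbsSummableAt p R) (hr : 0 ≤ r) (hrR : r < R) :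
    AbsSummableAt (PowerSeries.derivative 𝕜 p) r := by
  have hpos : 0 < R - r := sub_pos.2 hrR
  have h1 : Summable fun n => (R - r)⁻¹ * (‖coeff (n + 1) p‖ * R ^ (n + 1)) :=
    ((summable_nat_add_iff 1).2 h).mul_left _
  refine Summable.of_nonneg_of_le (fun n => by positivity) (fun n => ?_) h1
  have h2 := succ_mul_pow_mul_sub_le hr hrR.le n
  have h3 : ((n : ℝ) + 1) * r ^ n ≤ (R - r)⁻¹ * R ^ (n + 1) := by
    rw [inv_mul_eq_div, le_div_iff₀ hpos]; exact h2
  have h4 : ‖(n : 𝕜) + 1‖ = (n : ℝ) + 1 := by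
    have := RCLike.norm_natCast (K := 𝕜) (n + 1)
    push_cast at this; exact this
  rw [coeff_derivative, norm_mul, h4]
  calc _ = ‖coeff (n + 1) p‖ * (((n : ℝ) + 1) * r ^ n) := by ring
    _ ≤ ‖coeff (n + 1) p‖ * ((R - r)⁻¹ * R ^ (n + 1)) := by gcongr
    _ = _ := by ring

theorem hasDerivAt (h : AbsSummableAt p R) (hx : ‖x‖ < R) :
    HasDerivAt (seriesFun p) (seriesFun (PowerSeries.derivative 𝕜 p) x) x := by
  obtain ⟨r, hxr, hrR⟩ := exists_between hx
  have hr : 0 ≤ r := (norm_nonneg x).trans hxr.le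
  have hd := h.derivative hr hrR
  have hs : Summable fun n : ℕ => ‖coeff n p‖ * (n * r ^ (n - 1)) := by
    refine (summable_nat_add_iff 1).1 (hd.congr fun n => ?_)
    have h4 : ‖(n : 𝕜) + 1‖ = (n : ℝ) + 1 := by
      have := RCLike.norm_natCast (K := 𝕜) (n + 1)
      push_cast at this; exact this
    rw [coeff_derivative, norm_mul, h4, Nat.add_sub_cancel]; push_cast; ring
  have key := hasDerivAt_tsum_of_isPreconnected (𝕜 := 𝕜) (t := Metric.ball 0 r)
    (g := fun n y => coeff n p * y ^ n) (g' := fun n y => coeff n p * (n * y ^ (n - 1)))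
    (y₀ := x) (y := x) hs Metric.isOpen_ball
    (convex_ball (0 : 𝕜) r).isPreconnected
    (fun n y _ => (hasDerivAt_pow n y).const_mul _) (fun n y hy => ?_) (by simpa using hxr)
    (h.summable hx.le) (by simpa using hxr)
  · refine key.congr_deriv ?_
    have hsum : Summable fun n : ℕ => coeff n p * ((n : 𝕜) * x ^ (n - 1)) := by
      refine Summable.of_norm_bounded hs fun n => ?_
      rw [norm_mul, norm_mul, norm_pow, RCLike.norm_natCast]
      gcongr
    -- The term n = 0, where n - 1 truncates to 0, carries the factor 0 and drops out; the shifted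
    -- sum is the formal derivative.
    rw [hsum.tsum_eq_zero_add]
    simp only [seriesFun, coeff_derivative, Nat.cast_zero, zero_mul, mul_zero, zero_add,
      Nat.add_sub_cancel]
    refine tsum_congr fun n => ?_
    push_cast; ring
  · have hy' : ‖y‖ ≤ r := by simpa using (Metric.mem_ball.1 hy).le
    rw [norm_mul, norm_mul, norm_pow, RCLike.norm_natCast]
    gcongr

theorem mul_term (p q : PowerSeries 𝕜) (x : 𝕜) (n : ℕ) :
    ∑ kl ∈ Finset.HasAntidiagonal.antidiagonal n, coeff kl.1 p * x ^ kl.1 * (coeff kl.2 q * x ^ kl.2)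
      = coeff n (p * q) * x ^ n := by
  rw [coeff_mul, Finset.sum_mul]
  refine Finset.sum_congr rfl fun kl hkl => ?_
  rw [← Finset.HasAntidiagonal.mem_antidiagonal.1 hkl, pow_add]; ring

theorem mul (hr : 0 ≤ r) (hp : AbsSummableAt p r) (hq : AbsSummableAt q r) :
    AbsSummableAt (p * q) r := by
  have hx : ‖(r : 𝕜)‖ ≤ r := by rw [RCLike.norm_ofReal, abs_of_nonneg hr]
  have := summable_norm_sum_mul_antidiagonal_of_summable_norm (hp.summable_norm hx)
    (hq.summable_norm hx)
  refine this.congr fun n => ?_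
  rw [mul_term, norm_mul, norm_pow, RCLike.norm_ofReal, abs_of_nonneg hr]

theorem seriesFun_mul (hp : AbsSummableAt p r) (hq : AbsSummableAt q r) (hx : ‖x‖ ≤ r) :
    seriesFun (p * q) x = seriesFun p x * seriesFun q x := by
  rw [seriesFun, seriesFun, seriesFun, tsum_mul_tsum_eq_tsum_sum_antidiagonal_of_summable_norm
    (hp.summable_norm hx) (hq.summable_norm hx)]
  exact tsum_congr fun n => (mul_term p q x n).symm

theorem one (r : ℝ) : AbsSummableAt (1 : PowerSeries 𝕜) r :=
  summable_of_ne_finset_zero (s := {0}) fun n hn => by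
    rw [coeff_one, if_neg (by simpa using hn)]; simp

theorem pow (hr : 0 ≤ r) (hp : AbsSummableAt p r) (n : ℕ) : AbsSummableAt (p ^ n) r := by
  induction n with
  | zero => simpa using one r
  | succ n ih => rw [pow_succ]; exact ih.mul hr hp

theorem seriesFun_pow (hp : AbsSummableAt p r) (hx : ‖x‖ ≤ r) (n : ℕ) :
    seriesFun (p ^ n) x = seriesFun p x ^ n := by
  induction n with
  | zero =>
    rw [pow_zero, pow_zero, seriesFun, tsum_eq_single 0]
    · simp
    · intro n hn; rw [coeff_one, if_neg hn, zero_mul]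
  | succ n ih =>
    rw [pow_succ, pow_succ, seriesFun_mul (hp.pow ((norm_nonneg _).trans hx) n) hp hx, ih]

theorem map {p : PowerSeries ℝ} (hp : AbsSummableAt p r) :
    AbsSummableAt (p.map (algebraMap ℝ ℂ)) r := by
  simpa [AbsSummableAt] using hp

theorem _root_.seriesFun_map_ofReal (p : PowerSeries ℝ) (x : ℝ) :
    seriesFun (p.map (algebraMap ℝ ℂ)) (x : ℂ) = (seriesFun p x : ℝ) := by
  simp [seriesFun, Complex.ofReal_tsum]

theorem continuousOn (hp : AbsSummableAt p R) :
    ContinuousOn (seriesFun p) (Metric.ball 0 R) := fun x hx =>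
  (hp.hasDerivAt (by simpa using hx)).continuousAt.continuousWithinAt

/-- Cauchy's formula for the coefficients, on the circle of radius `r`. -/
theorem integral_seriesFun {p : PowerSeries ℂ} (hr : 0 ≤ r) (hp : AbsSummableAt p r) (m : ℕ) :
    ∫ θ in (-Real.pi)..Real.pi, seriesFun p (r * Complex.exp (θ * Complex.I))
        * Complex.exp (-(m * θ * Complex.I)) = 2 * Real.pi * (coeff m p * r ^ m) := by
  have hnorm : ∀ θ : ℝ, ‖(r : ℂ) * Complex.exp (θ * Complex.I)‖ ≤ r := fun θ => by
    rw [norm_mul, Complex.norm_exp_ofReal_mul_I, mul_one, Complex.norm_real,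
      Real.norm_of_nonneg hr]
  set F : ℕ → ℝ → ℂ := fun n θ => coeff n p * (r * Complex.exp (θ * Complex.I)) ^ n
    * Complex.exp (-(m * θ * Complex.I)) with hF
  have hF' : ∀ n θ, F n θ = coeff n p * r ^ n * Complex.exp (((n : ℂ) - m) * Complex.I * θ) := by
    intro n θ
    rw [hF]
    simp only
    have h1 : Complex.exp (((n : ℂ) - m) * Complex.I * θ)
        = Complex.exp (n * (θ * Complex.I)) * Complex.exp (-(m * θ * Complex.I)) := by
      rw [← Complex.exp_add]; ring_nf
    rw [mul_pow, ← Complex.exp_nat_mul, h1]; ring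
  have hFn : ∀ n θ, ‖F n θ‖ ≤ ‖coeff n p‖ * r ^ n := by
    intro n θ
    have : ((n : ℂ) - m) * Complex.I * θ = (((n : ℝ) - m) * θ : ℝ) * Complex.I := by
      push_cast; ring
    rw [hF', this, norm_mul, Complex.norm_exp_ofReal_mul_I, mul_one, norm_mul, norm_pow,
      Complex.norm_real, Real.norm_of_nonneg hr]
  have hint := intervalIntegral.hasSum_integral_of_dominated_convergence
    (μ := MeasureTheory.volume) (a := -Real.pi) (b := Real.pi)
    (F := F) (f := fun θ => seriesFun p (r * Complex.exp (θ * Complex.I))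
        * Complex.exp (-(m * θ * Complex.I)))
    (fun n _ => ‖coeff n p‖ * r ^ n)
    (fun n => by
      have : Continuous (F n) := by simp only [hF]; fun_prop
      exact this.aestronglyMeasurable)
    (fun n => Filter.Eventually.of_forall fun θ _ => hFn n θ)
    (Filter.Eventually.of_forall fun θ _ => hp)
    (intervalIntegrable_const)
    (Filter.Eventually.of_forall fun θ _ => ((hp.summable (hnorm θ)).hasSum.mul_right _))
  refine hint.unique ?_
  have hval : ∀ n, ∫ θ in (-Real.pi)..Real.pi, F n θ
      = if n = m then 2 * Real.pi * (coeff m p * r ^ m) else 0 := by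
    intro n
    simp only [hF']
    rw [intervalIntegral.integral_const_mul]
    split_ifs with h
    · subst h
      simp only [sub_self, zero_mul, Complex.exp_zero, intervalIntegral.integral_const]
      rw [sub_neg_eq_add, Complex.real_smul]; push_cast; ring
    · have hne : ((n : ℂ) - m) * Complex.I ≠ 0 :=
        mul_ne_zero (sub_ne_zero.2 (by exact_mod_cast h)) Complex.I_ne_zero
      rw [integral_exp_mul_complex hne]
      have : Complex.exp (((n : ℂ) - m) * Complex.I * (Real.pi : ℝ))
          = Complex.exp (((n : ℂ) - m) * Complex.I * ((-Real.pi : ℝ) : ℂ)) := by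
        rw [Complex.exp_eq_exp_iff_exists_int]
        exact ⟨(n : ℤ) - m, by push_cast; ring⟩
      rw [this, sub_self, zero_div, mul_zero]
  simp only [hval]
  exact hasSum_ite_eq m _

end AbsSummableAt

end SeriesAnalysis

/-! ### Strict maximum of the modulus on a circle. -/

section Positivity

theorem seriesFun_nonneg_le {φ : PowerSeries ℝ} {r : ℝ} (hr : 0 ≤ r)
    (hφ : ∀ k, 0 ≤ coeff k φ) (hs : AbsSummableAt φ r) (k : ℕ) :
    coeff k φ * r ^ k ≤ seriesFun φ r :=
  (hs.summable (by rw [Real.norm_of_nonneg hr])).le_tsum k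
    fun j _ => mul_nonneg (hφ j) (pow_nonneg hr j)

theorem seriesFun_pos {φ : PowerSeries ℝ} {r : ℝ} (hr : 0 < r)
    (hφ : ∀ k, 0 ≤ coeff k φ) (hs : AbsSummableAt φ r) {k : ℕ} (hk : coeff k φ ≠ 0) :
    0 < seriesFun φ r :=
  (mul_pos ((hφ k).lt_of_ne' hk) (pow_pos hr k)).trans_le (seriesFun_nonneg_le hr.le hφ hs k)

theorem norm_add_mul_lt_of_ne_one {a b : ℝ} (ha : 0 < a) (hb : 0 < b) {z : ℂ} (hz : ‖z‖ = 1)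
    (hz1 : z ≠ 1) : ‖(a : ℂ) + b * z‖ < a + b := by
  have hna : ‖(a : ℂ)‖ = a := by rw [Complex.norm_real, Real.norm_of_nonneg ha.le]
  have hnb : ‖(b : ℂ) * z‖ = b := by
    rw [norm_mul, hz, mul_one, Complex.norm_real, Real.norm_of_nonneg hb.le]
  have := norm_add_lt_of_not_sameRay (x := (a : ℂ)) (y := (b : ℂ) * z) (fun h => hz1 ?_)
  · rwa [hna, hnb] at this
  · rw [sameRay_iff_norm_smul_eq, hna, hnb] at h
    have h' : (b : ℂ) * a * z = b * a * 1 := by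
      simp only [Complex.real_smul] at h
      linear_combination h
    exact mul_left_cancel₀ (by exact_mod_cast (mul_pos hb ha).ne') h'

/-- A series with nonnegative coefficients attains its maximum modulus on a circle at another
point only if all its monomials agree there. -/
theorem norm_seriesFun_lt {φ : PowerSeries ℝ} {r : ℝ} (hr : 0 < r)
    (hφ : ∀ k, 0 ≤ coeff k φ) (hs : AbsSummableAt φ r) (hφ0 : coeff 0 φ ≠ 0) {z : ℂ}
    (hz : ‖z‖ = 1) {k : ℕ} (hk : coeff k φ ≠ 0) (hzk : z ^ k ≠ 1) :
    ‖seriesFun (φ.map (algebraMap ℝ ℂ)) (r * z)‖ < seriesFun φ r := by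
  have hk0 : (0 : ℕ) ≠ k := by rintro rfl; simp at hzk
  have hnz : ‖(r : ℂ) * z‖ ≤ r := by
    rw [norm_mul, hz, mul_one, Complex.norm_real, Real.norm_of_nonneg hr.le]
  have hsC := hs.map.summable hnz
  have hsR := hs.summable (x := r) (by rw [Real.norm_of_nonneg hr.le])
  have hterm : ∀ n, coeff n (φ.map (algebraMap ℝ ℂ)) * (r * z) ^ n
      = ((coeff n φ * r ^ n : ℝ) : ℂ) * z ^ n := by
    intro n; simp [mul_pow, mul_assoc]
  have hnt : ∀ n, ‖coeff n (φ.map (algebraMap ℝ ℂ)) * (r * z) ^ n‖ = coeff n φ * r ^ n := by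
    intro n
    rw [hterm, norm_mul, norm_pow, hz, one_pow, mul_one, Complex.norm_real,
      Real.norm_of_nonneg (mul_nonneg (hφ n) (pow_nonneg hr.le n))]
  -- The terms 0 and k point in different directions, so their sum is strictly shorter; the termwise
  -- bound suffices for the rest.
  rw [seriesFun, seriesFun, ← hsC.sum_add_tsum_compl (s := {0, k}),
    ← hsR.sum_add_tsum_compl (s := {0, k}), Finset.sum_pair hk0, Finset.sum_pair hk0]
  refine (norm_add_le _ _).trans_lt (add_lt_add_of_lt_of_le ?_ ?_)
  · rw [hterm, hterm, pow_zero z, mul_one]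
    refine norm_add_mul_lt_of_ne_one ?_ ?_ (by rw [norm_pow, hz, one_pow]) hzk
    · exact mul_pos ((hφ 0).lt_of_ne' hφ0) (pow_pos hr 0)
    · exact mul_pos ((hφ k).lt_of_ne' hk) (pow_pos hr k)
  · refine (norm_tsum_le_tsum_norm ?_).trans_eq (tsum_congr fun n => hnt n)
    exact (hsR.subtype _).congr fun n => (hnt n).symm

/-- If the modulus were maximal at z = e^{iθ}, all exponents k in the support would satisfy z^k = 1.
The integers m with z^m = 1 form a subgroup, so aperiodicity gives z = 1, hence θ = 0. -/
theorem IsAperiodicSeries.norm_seriesFun_exp_lt {φ : PowerSeries ℝ} (hap : IsAperiodicSeries φ)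
    {r : ℝ} (hr : 0 < r) (hφ : ∀ k, 0 ≤ coeff k φ) (hs : AbsSummableAt φ r)
    (hφ0 : coeff 0 φ ≠ 0) {θ : ℝ} (hθ : |θ| ≤ Real.pi) (hθ0 : θ ≠ 0) :
    ‖seriesFun (φ.map (algebraMap ℝ ℂ)) (r * Complex.exp (θ * Complex.I))‖ < seriesFun φ r := by
  by_contra hcon
  set z := Complex.exp (θ * Complex.I) with hz
  have hz0 : z ≠ 0 := Complex.exp_ne_zero _
  have hk : ∀ k, coeff k φ ≠ 0 → z ^ k = 1 := fun k hk => by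
    by_contra h
    exact hcon (norm_seriesFun_lt hr hφ hs hφ0 (Complex.norm_exp_ofReal_mul_I θ) hk h)
  have hall : ∀ m ∈ AddSubgroup.closure {m : ℤ | ∃ k : ℕ, coeff k φ ≠ 0 ∧ m = (k : ℤ)},
      z ^ m = 1 := by
    intro m hm
    induction hm using AddSubgroup.closure_induction with
    | mem x hx => obtain ⟨k, h1, rfl⟩ := hx; rw [zpow_natCast]; exact hk k h1
    | zero => simp
    | add x y _ _ hx hy => rw [zpow_add₀ hz0, hx, hy, one_mul]
    | neg x _ hx => rw [zpow_neg, hx, inv_one]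
  have h1 : z = 1 := by
    have := hall 1 (by rw [show AddSubgroup.closure _ = ⊤ from hap]; trivial)
    simpa using this
  obtain ⟨n, hn⟩ := Complex.exp_eq_one_iff.1 (hz ▸ h1)
  have hn' : θ = n * (2 * Real.pi) := by
    have : (θ : ℂ) = n * (2 * Real.pi) := by
      apply mul_right_cancel₀ Complex.I_ne_zero
      rw [hn]; ring
    exact_mod_cast this
  have hpi := Real.pi_pos
  rw [hn', abs_mul, abs_of_pos (by positivity : (0 : ℝ) < 2 * Real.pi)] at hθ
  have h2 : |(n : ℝ)| < 1 := by nlinarith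
  have h3 : n = 0 := by
    have : |n| < 1 := by exact_mod_cast h2
    exact Int.abs_lt_one_iff.1 this
  exact hθ0 (by rw [hn', h3]; simp)

end Positivity

/-! ### Laplace's method: Gaussian integrals and the local expansion. -/

section Laplace

/-- The error scale `n^(-1/2 - N)`. -/
noncomputable def laplaceScale (N : ℕ) (n : ℕ) : ℝ := (√(n : ℝ))⁻¹ * ((n : ℝ) ^ N)⁻¹

theorem isBigO_pow_laplaceScale {r : ℝ} (hr0 : 0 ≤ r) (hr : r < 1) (N : ℕ) :
    (fun n : ℕ => r ^ n) =O[atTop] laplaceScale N := by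
  -- The exponent N + 1 suffices because √n ≤ n rounds the half power up.
  have h1 := (isLittleO_pow_const_mul_const_pow_const_pow_of_norm_lt (R := ℝ) (N + 1)
    (r₁ := r) (r₂ := 1) (by rwa [Real.norm_of_nonneg hr0])).isBigO
  obtain ⟨C, hC⟩ := h1.bound
  refine IsBigO.of_bound C ?_
  filter_upwards [hC, eventually_ge_atTop 1] with n hn hn1
  have hn' : (1 : ℝ) ≤ n := by exact_mod_cast hn1
  have hn0 : (0 : ℝ) < n := by linarith
  rw [one_pow, norm_one, mul_one, norm_mul, norm_pow, Real.norm_of_nonneg hn0.le] at hn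
  have hsq : √(n : ℝ) ≤ n := by
    rw [Real.sqrt_le_left hn0.le]; nlinarith
  have hsq0 : 0 < √(n : ℝ) := Real.sqrt_pos.2 hn0
  have hC0 : 0 ≤ C := le_trans (by positivity) hn
  rw [laplaceScale, Real.norm_of_nonneg (by positivity : (0 : ℝ) ≤ (√(n : ℝ))⁻¹ * ((n : ℝ) ^ N)⁻¹),
    ← mul_inv, ← div_eq_mul_inv, le_div_iff₀ (by positivity)]
  calc ‖r ^ n‖ * (√(n : ℝ) * (n : ℝ) ^ N) ≤ ‖r ^ n‖ * (n * (n : ℝ) ^ N) := by gcongr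
    _ = (n : ℝ) ^ (N + 1) * ‖r ^ n‖ := by ring
    _ ≤ C := hn

theorem laplaceScale_succ (N : ℕ) :
    laplaceScale (N + 1) = fun n : ℕ => (n : ℝ)⁻¹ * laplaceScale N n := by
  funext n; simp only [laplaceScale, pow_succ, mul_inv]; ring

theorem sq_cpow_half {u : ℂ} (hu : 0 < u.re) : (u ^ 2) ^ (1 / 2 : ℂ) = u := by
  have h := abs_lt.1 (Complex.abs_arg_lt_pi_div_two_iff.2 (Or.inl hu))
  have := Complex.pow_cpow_nat_inv (x := u) (n := 2) two_ne_zero (by push_cast; linarith)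
    (by push_cast; linarith [h.2])
  simpa using this

/-- The value is independent of the direction z: since Re z > 0, the principal root of π / (n z²/2)
is √(2π/n) / z, and the factor z cancels. -/
theorem integral_Ioi_gaussian_direction {z : ℂ} (hz : 0 < z.re) (hz2 : 0 < (z ^ 2).re) {n : ℕ}
    (hn : 1 ≤ n) :
    z * ∫ t in Set.Ioi (0 : ℝ), Complex.exp (-(n * z ^ 2 / 2) * (t : ℂ) ^ 2)
      = √(Real.pi / (2 * n)) := by
  have hn0 : (0 : ℝ) < n := by exact_mod_cast hn
  have hz0 : z ≠ 0 := by rintro rfl; simp at hz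
  have hb : 0 < (n * z ^ 2 / 2).re := by
    have : (n * z ^ 2 / 2 : ℂ) = ((n / 2 : ℝ) : ℂ) * z ^ 2 := by push_cast; ring
    rw [this, Complex.re_ofReal_mul]; positivity
  have hq : ((Real.pi : ℂ) / (n * z ^ 2 / 2)) = ((√(2 * Real.pi / n) : ℝ) / z) ^ 2 := by
    rw [div_pow, ← Complex.ofReal_pow, Real.sq_sqrt (by positivity)]
    push_cast
    have : (n : ℂ) ≠ 0 := by exact_mod_cast hn0.ne'
    field_simp
  have hre : 0 < ((√(2 * Real.pi / n) : ℝ) / z : ℂ).re := by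
    rw [div_eq_mul_inv, Complex.re_ofReal_mul, Complex.inv_re]
    have : 0 < Complex.normSq z := Complex.normSq_pos.2 hz0
    have : 0 < √(2 * Real.pi / n) := Real.sqrt_pos.2 (by positivity)
    positivity
  rw [integral_gaussian_complex_Ioi hb, hq, sq_cpow_half hre]
  have : (√(Real.pi / (2 * n)) : ℝ) = √(2 * Real.pi / n) / 2 := by
    rw [show Real.pi / (2 * n) = (2 * Real.pi / n) / 2 ^ 2 by field_simp,
      Real.sqrt_div (by positivity), Real.sqrt_sq (by norm_num)]
  rw [this]; push_cast; field_simp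

/-- The difference from the full ray is the tail t > 1, which decays exponentially in n. -/
theorem norm_integral_segment_sub_le {z : ℂ} (hz : 0 < z.re) (hz2 : 0 < (z ^ 2).re) :
    ∃ C r : ℝ, 0 ≤ r ∧ r < 1 ∧ ∀ n : ℕ, 1 ≤ n →
      ‖(z * ∫ t in (0 : ℝ)..1, Complex.exp (-(n * z ^ 2 / 2) * (t : ℂ) ^ 2))
        - √(Real.pi / (2 * n))‖ ≤ C * r ^ n := by
  set c : ℝ := (z ^ 2).re / 2 with hc
  have hc0 : 0 < c := by positivity
  set D : ℝ := ∫ t in Set.Ioi (1 : ℝ), Real.exp (-c * t ^ 2)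
  refine ⟨‖z‖ * (Real.exp c * D), Real.exp (-c), (Real.exp_pos _).le,
    Real.exp_lt_one_iff.2 (by linarith), fun n hn => ?_⟩
  have hn0 : (1 : ℝ) ≤ n := by exact_mod_cast hn
  have hbre : (n * z ^ 2 / 2 : ℂ).re = n * c := by
    have : (n * z ^ 2 / 2 : ℂ) = ((n / 2 : ℝ) : ℂ) * z ^ 2 := by push_cast; ring
    rw [this, Complex.re_ofReal_mul, hc]; ring
  have hb : 0 < (n * z ^ 2 / 2 : ℂ).re := by rw [hbre]; positivity
  have hint := integrable_cexp_neg_mul_sq hb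
  have hsplit := intervalIntegral.integral_Ioi_sub_Ioi (μ := MeasureTheory.volume)
    (hint.integrableOn (s := Set.Ioi (0 : ℝ))) zero_le_one
  rw [← hsplit, mul_sub, integral_Ioi_gaussian_direction hz hz2 hn, sub_sub_cancel_left, norm_neg,
    norm_mul, mul_assoc]
  gcongr
  -- This is (n - 1)(t² - 1) ≥ 0 exponentiated; it separates the decay in n from the integrability
  -- in t.
  have hpt : ∀ t ∈ Set.Ioi (1 : ℝ), ‖Complex.exp (-(n * z ^ 2 / 2) * (t : ℂ) ^ 2)‖
      ≤ Real.exp c * Real.exp (-c) ^ n * Real.exp (-c * t ^ 2) := by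
    intro t ht
    have ht1 : (1 : ℝ) ≤ t ^ 2 := one_le_pow₀ (le_of_lt ht)
    rw [norm_cexp_neg_mul_sq, hbre, ← Real.exp_nat_mul, ← Real.exp_add, ← Real.exp_add,
      Real.exp_le_exp]
    have := mul_nonneg (mul_nonneg (sub_nonneg.2 hn0) hc0.le) (sub_nonneg.2 ht1)
    nlinarith
  calc _ ≤ ∫ t in Set.Ioi (1 : ℝ), Real.exp c * Real.exp (-c) ^ n * Real.exp (-c * t ^ 2) := by
        refine MeasureTheory.norm_integral_le_of_norm_le
          (((integrable_exp_neg_mul_sq hc0).integrableOn).const_mul _) ?_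
        exact (MeasureTheory.ae_restrict_iff' measurableSet_Ioi).2 (Eventually.of_forall hpt)
    _ = _ := by rw [MeasureTheory.integral_const_mul]; ring

/-- A holomorphic phase `w(θ) = θ s(θ)` near the real segment `[-δ, δ]`, for which
`exp (-n w² / 2)` is concentrated at the origin. -/
structure IsLaplacePhase (w s : ℂ → ℂ) (ρ δ c : ℝ) : Prop where
  delta_pos : 0 < δ
  delta_lt : δ < ρ
  c_pos : 0 < c
  eq_mul : ∀ θ, w θ = θ * s θ
  diff : DifferentiableOn ℂ s (Metric.ball 0 ρ)
  s_ne : ∀ θ ∈ Metric.ball (0 : ℂ) ρ, s θ ≠ 0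
  deriv_ne : ∀ θ ∈ Metric.ball (0 : ℂ) ρ, deriv w θ ≠ 0
  re_sq : ∀ θ : ℝ, |θ| ≤ δ → c * θ ^ 2 ≤ (w θ ^ 2).re
  re_right : 0 < (w (δ : ℝ)).re
  re_left : (w (-δ : ℝ)).re < 0

/-- The local Laplace integral of `G` with the phase `w`. -/
noncomputable def laplaceIntegral (w : ℂ → ℂ) (δ : ℝ) (G : ℂ → ℂ) (n : ℕ) : ℂ :=
  ∫ θ in (-δ)..δ, G (θ : ℂ) * Complex.exp (-(n * w θ ^ 2 / 2))

namespace IsLaplacePhase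

variable {w s : ℂ → ℂ} {ρ δ c : ℝ}

theorem rho_pos (h : IsLaplacePhase w s ρ δ c) : 0 < ρ := h.delta_pos.trans h.delta_lt

theorem mem_ball (h : IsLaplacePhase w s ρ δ c) {θ : ℝ} (hθ : θ ∈ Set.uIcc (-δ) δ) :
    (θ : ℂ) ∈ Metric.ball (0 : ℂ) ρ := by
  have h0 := h.delta_pos
  rw [Set.uIcc_of_le (by linarith)] at hθ
  rw [mem_ball_zero_iff, Complex.norm_real, Real.norm_eq_abs]
  exact (abs_le.2 hθ).trans_lt h.delta_lt

theorem diff_w (h : IsLaplacePhase w s ρ δ c) : DifferentiableOn ℂ w (Metric.ball 0 ρ) := by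
  have : w = fun θ => θ * s θ := funext h.eq_mul
  rw [this]; exact differentiableOn_id.mul h.diff

theorem hasDerivAt (_h : IsLaplacePhase w s ρ δ c) {F : ℂ → ℂ}
    (hF : DifferentiableOn ℂ F (Metric.ball 0 ρ)) {θ : ℂ} (hθ : θ ∈ Metric.ball (0 : ℂ) ρ) :
    HasDerivAt F (deriv F θ) θ :=
  (hF.differentiableAt (Metric.isOpen_ball.mem_nhds hθ)).hasDerivAt

theorem continuousOn_real (h : IsLaplacePhase w s ρ δ c) {F : ℂ → ℂ}
    (hF : DifferentiableOn ℂ F (Metric.ball 0 ρ)) :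
    ContinuousOn (fun θ : ℝ => F θ) (Set.uIcc (-δ) δ) :=
  hF.continuousOn.comp Complex.continuous_ofReal.continuousOn fun _ hθ => h.mem_ball hθ

theorem diff_exp (h : IsLaplacePhase w s ρ δ c) (n : ℕ) :
    DifferentiableOn ℂ (fun θ => Complex.exp (-(n * w θ ^ 2 / 2))) (Metric.ball 0 ρ) := by
  have := h.diff_w
  fun_prop

theorem re_sq_pos (h : IsLaplacePhase w s ρ δ c) {θ : ℝ} (hθ : |θ| = δ) : 0 < (w θ ^ 2).re := by
  refine lt_of_lt_of_le ?_ (h.re_sq θ hθ.le)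
  have h1 := h.c_pos
  have h2 := h.delta_pos
  rw [← sq_abs, hθ]; positivity

theorem norm_exp (n : ℕ) (θ : ℝ) :
    ‖Complex.exp (-(n * w θ ^ 2 / 2))‖ = Real.exp (-(n * (w θ ^ 2).re / 2)) := by
  rw [Complex.norm_exp]
  congr 1
  have : (-(n * w θ ^ 2 / 2) : ℂ) = ((-(n / 2) : ℝ) : ℂ) * w θ ^ 2 := by push_cast; ring
  rw [this, Complex.re_ofReal_mul]; ring

/-- For the amplitude w' the integrand is exact: if P is an entire primitive of exp(-n u²/2), the
integral is P(w(δ)) - P(w(-δ)). Going through P(0) along straight segments, each half contributes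
√(π/(2n)) up to an exponentially small error. The left half uses -w(-δ), which lies in the right
half-plane and has the same square. -/
theorem laplaceIntegral_deriv (h : IsLaplacePhase w s ρ δ c) (N : ℕ) :
    (fun n : ℕ => laplaceIntegral w δ (deriv w) n - (√(2 * Real.pi) : ℝ) * ((√(n : ℝ))⁻¹ : ℝ))
      =O[atTop] laplaceScale N := by
  have hδ := h.delta_pos
  have hz1 : 0 < (w (δ : ℝ)).re := h.re_right
  have hz2 : 0 < (-w (-δ : ℝ)).re := by rw [Complex.neg_re]; linarith [h.re_left]
  have hs1 : 0 < (w (δ : ℝ) ^ 2).re := h.re_sq_pos (abs_of_pos hδ)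
  have hs2 : 0 < ((-w (-δ : ℝ)) ^ 2).re := by
    rw [neg_sq]; exact h.re_sq_pos (by rw [abs_neg, abs_of_pos hδ])
  obtain ⟨C₁, r₁, hr₁, hr₁', hb₁⟩ := norm_integral_segment_sub_le hz1 hs1
  obtain ⟨C₂, r₂, hr₂, hr₂', hb₂⟩ := norm_integral_segment_sub_le hz2 hs2
  have hfin : (fun n : ℕ => C₁ * r₁ ^ n + C₂ * r₂ ^ n) =O[atTop] laplaceScale N :=
    ((isBigO_pow_laplaceScale hr₁ hr₁' N).const_mul_left _).add
      ((isBigO_pow_laplaceScale hr₂ hr₂' N).const_mul_left _)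
  refine IsBigO.trans (IsBigO.of_bound 1 ?_) hfin
  filter_upwards [eventually_ge_atTop 1] with n hn
  have hn0 : (0 : ℝ) < n := by exact_mod_cast hn
  have hent : Differentiable ℂ fun u : ℂ => Complex.exp (-(n * u ^ 2 / 2)) := by fun_prop
  obtain ⟨P, hP⟩ := hent.isExactOn_univ
  have hseg : ∀ z : ℂ, P z - P 0
      = z * ∫ t in (0 : ℝ)..1, Complex.exp (-(n * z ^ 2 / 2) * (t : ℂ) ^ 2) := by
    intro z
    have hd : ∀ t ∈ Set.uIcc (0 : ℝ) 1, HasDerivAt (fun t : ℝ => P (t * z))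
        (z * Complex.exp (-(n * z ^ 2 / 2) * (t : ℂ) ^ 2)) t := by
      intro t _
      have h1 : HasDerivAt (fun u : ℂ => u * z) z (t : ℂ) := by
        simpa using (hasDerivAt_id (t : ℂ)).mul_const z
      have h2 := (HasDerivAt.comp (t : ℂ) (hP (t * z) trivial) h1).comp_ofReal
      refine h2.congr_deriv ?_
      rw [mul_comm]; congr 2; ring_nf
    have := intervalIntegral.integral_eq_sub_of_hasDerivAt hd
      (Continuous.intervalIntegrable (by fun_prop) _ _)
    rw [intervalIntegral.integral_const_mul] at this
    rw [this]; simp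
  have hmain : laplaceIntegral w δ (deriv w) n = P (w (δ : ℝ)) - P (w (-δ : ℝ)) := by
    refine intervalIntegral.integral_eq_sub_of_hasDerivAt (f := fun θ : ℝ => P (w θ))
      (fun θ hθ => ?_) ?_
    · have h1 := h.hasDerivAt h.diff_w (h.mem_ball hθ)
      refine (HasDerivAt.comp (θ : ℂ) (hP (w θ) trivial) h1).comp_ofReal.congr_deriv ?_
      rw [mul_comm]
    · exact (h.continuousOn_real ((h.diff_w.deriv Metric.isOpen_ball).mul
        (h.diff_exp n))).intervalIntegrable
  have hR := hb₁ n hn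
  have hL := hb₂ n hn
  rw [← hseg] at hR
  have hL' := hseg (w (-δ : ℝ))
  have hsq : ((√(2 * Real.pi) : ℝ) : ℂ) * ((√(n : ℝ))⁻¹ : ℝ)
      = (√(Real.pi / (2 * n)) : ℝ) + (√(Real.pi / (2 * n)) : ℝ) := by
    have : √(2 * Real.pi) * (√(n : ℝ))⁻¹ = √(Real.pi / (2 * n)) + √(Real.pi / (2 * n)) := by
      rw [← two_mul, ← div_eq_mul_inv, ← Real.sqrt_div (by positivity),
        show 2 * Real.pi / (n : ℝ) = 2 ^ 2 * (Real.pi / (2 * n)) by field_simp,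
        Real.sqrt_mul (by norm_num), Real.sqrt_sq (by norm_num)]
    exact_mod_cast this
  rw [neg_sq] at hL
  have hid : laplaceIntegral w δ (deriv w) n - (√(2 * Real.pi) : ℝ) * ((√(n : ℝ))⁻¹ : ℝ)
      = (P (w (δ : ℝ)) - P 0 - (√(Real.pi / (2 * n)) : ℝ))
        + ((-w (-δ : ℝ) * ∫ t in (0 : ℝ)..1,
            Complex.exp (-(n * w (-δ : ℝ) ^ 2 / 2) * (t : ℂ) ^ 2))
          - (√(Real.pi / (2 * n)) : ℝ)) := by
    rw [hmain, hsq]; linear_combination -hL'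
  rw [hid, one_mul]
  exact ((norm_add_le _ _).trans (add_le_add hR hL)).trans (le_abs_self _)

end IsLaplacePhase

namespace IsLaplacePhase

variable {w s : ℂ → ℂ} {ρ δ c : ℝ}

theorem isBigO_exp_endpoint {θ : ℝ} (hθ : 0 < (w θ ^ 2).re) (N : ℕ) :
    (fun n : ℕ => Complex.exp (-(n * w θ ^ 2 / 2))) =O[atTop] laplaceScale N := by
  refine IsBigO.trans (IsBigO.of_norm_eventuallyLE (Eventually.of_forall fun n => ?_))
    (isBigO_pow_laplaceScale (r := Real.exp (-((w θ ^ 2).re / 2))) (Real.exp_pos _).le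
      (Real.exp_lt_one_iff.2 (by linarith)) N)
  beta_reduce
  rw [norm_exp, ← Real.exp_nat_mul]
  apply le_of_eq
  ring_nf

/-- Integration by parts reduces a Laplace integral to one that carries a factor `1 / n`. -/
theorem exists_laplaceIntegral_step (h : IsLaplacePhase w s ρ δ c) {G : ℂ → ℂ}
    (hG : DifferentiableOn ℂ G (Metric.ball 0 ρ)) :
    ∃ G₁ : ℂ → ℂ, DifferentiableOn ℂ G₁ (Metric.ball 0 ρ) ∧ ∀ N,
      (fun n : ℕ => laplaceIntegral w δ G n
        - G 0 / deriv w 0 * ((√(2 * Real.pi) : ℝ) * ((√(n : ℝ))⁻¹ : ℝ))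
        - (n : ℂ)⁻¹ * laplaceIntegral w δ G₁ n) =O[atTop] laplaceScale N := by
  have hδ := h.delta_pos
  have hρ := h.rho_pos
  have hw' := h.diff_w.deriv Metric.isOpen_ball
  -- This a makes E = G - a w' vanish at 0, so E is divisible by w w' = θ s w' and the quotient q is
  -- holomorphic.
  set a : ℂ := G 0 / deriv w 0 with ha
  set E : ℂ → ℂ := fun θ => G θ - a * deriv w θ with hE
  have hEd : DifferentiableOn ℂ E (Metric.ball 0 ρ) := hG.sub (hw'.const_mul a)
  have hE0 : E 0 = 0 := by
    have := h.deriv_ne 0 (Metric.mem_ball_self hρ)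
    simp only [hE, ha]; field_simp; ring
  have hEs := (Complex.differentiableOn_dslope (Metric.ball_mem_nhds (0 : ℂ) hρ)).2 hEd
  set q : ℂ → ℂ := fun θ => dslope E 0 θ / (s θ * deriv w θ) with hq
  have hqd : DifferentiableOn ℂ q (Metric.ball 0 ρ) :=
    hEs.div (h.diff.mul hw') fun θ hθ => mul_ne_zero (h.s_ne θ hθ) (h.deriv_ne θ hθ)
  have hEq : ∀ θ ∈ Metric.ball (0 : ℂ) ρ, G θ = a * deriv w θ + w θ * deriv w θ * q θ := by
    intro θ hθ
    have h1 := sub_smul_dslope E 0 θ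
    rw [hE0, sub_zero, sub_zero, smul_eq_mul] at h1
    have h2 := h.s_ne θ hθ
    have h3 := h.deriv_ne θ hθ
    have h4 : w θ * deriv w θ * q θ = θ * dslope E 0 θ := by
      simp only [hq]; rw [h.eq_mul θ]; field_simp
    rw [h4, h1]; simp only [hE]; ring
  -- The new amplitude is q' because w w' exp(-n w²/2) is -1/n times the derivative of exp(-n w²/2).
  refine ⟨deriv q, hqd.deriv Metric.isOpen_ball, fun N => ?_⟩
  set e : ℕ → ℝ → ℂ := fun n θ => Complex.exp (-(n * w θ ^ 2 / 2)) with he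
  have hO1 := (h.laplaceIntegral_deriv N).const_mul_left a
  have hone : (fun n : ℕ => (n : ℂ)⁻¹) =O[atTop] fun _ => (1 : ℝ) := by
    refine IsBigO.of_bound 1 (eventually_atTop.2 ⟨1, fun n hn => ?_⟩)
    rw [norm_inv, Complex.norm_natCast, norm_one, mul_one]
    exact inv_le_one_of_one_le₀ (by exact_mod_cast hn)
  have hb : (fun n : ℕ => q (δ : ℝ) * e n δ - q (-δ : ℝ) * e n (-δ)) =O[atTop] laplaceScale N :=
    ((isBigO_exp_endpoint (h.re_sq_pos (abs_of_pos hδ)) N).const_mul_left _).sub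
      ((isBigO_exp_endpoint (h.re_sq_pos (by rw [abs_neg, abs_of_pos hδ])) N).const_mul_left _)
  have hO2 := hone.mul hb
  simp only [one_mul] at hO2
  refine (hO1.sub hO2).congr' ?_ EventuallyEq.rfl
  filter_upwards [eventually_ge_atTop 1] with n hn
  have hn0 : (n : ℂ) ≠ 0 := by exact_mod_cast (by omega : n ≠ 0)
  have hexp := h.diff_exp n
  have hi1 : IntervalIntegrable (fun θ : ℝ => deriv w θ * e n θ) MeasureTheory.volume (-δ) δ :=
    (h.continuousOn_real (hw'.mul hexp)).intervalIntegrable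
  have hi2 : IntervalIntegrable (fun θ : ℝ => w θ * deriv w θ * q θ * e n θ)
      MeasureTheory.volume (-δ) δ :=
    (h.continuousOn_real (((h.diff_w.mul hw').mul hqd).mul hexp)).intervalIntegrable
  have hi3 : IntervalIntegrable (fun θ : ℝ => deriv q θ * e n θ) MeasureTheory.volume (-δ) δ :=
    (h.continuousOn_real ((hqd.deriv Metric.isOpen_ball).mul hexp)).intervalIntegrable
  have hdec : laplaceIntegral w δ G n = a * laplaceIntegral w δ (deriv w) n
      + ∫ θ in (-δ)..δ, w θ * deriv w θ * q θ * e n θ := by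
    rw [laplaceIntegral, laplaceIntegral, ← intervalIntegral.integral_const_mul,
      ← intervalIntegral.integral_add (hi1.const_mul a) hi2]
    refine intervalIntegral.integral_congr fun θ hθ => ?_
    simp only [he]
    rw [hEq θ (h.mem_ball hθ)]; ring
  have hparts : laplaceIntegral w δ (deriv q) n
      - n * ∫ θ in (-δ)..δ, w θ * deriv w θ * q θ * e n θ
      = q (δ : ℝ) * e n δ - q (-δ : ℝ) * e n (-δ) := by
    rw [laplaceIntegral, ← intervalIntegral.integral_const_mul,
      ← intervalIntegral.integral_sub hi3 (hi2.const_mul _)]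
    refine intervalIntegral.integral_eq_sub_of_hasDerivAt (f := fun θ : ℝ => q θ * e n θ)
      (fun θ hθ => ?_) (hi3.sub (hi2.const_mul _))
    have hθ' := h.mem_ball hθ
    have d1 := h.hasDerivAt hqd hθ'
    have d2 := h.hasDerivAt h.diff_w hθ'
    have d3 := ((((d2.pow 2).const_mul (n : ℂ)).div_const 2).neg).cexp
    refine (d1.mul d3).comp_ofReal.congr_deriv ?_
    simp only [he, Pi.neg_apply, Pi.pow_apply, Nat.cast_ofNat]
    ring
  have hfin : ∫ θ in (-δ)..δ, w θ * deriv w θ * q θ * e n θ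
      = (n : ℂ)⁻¹ * (laplaceIntegral w δ (deriv q) n
        - (q (δ : ℝ) * e n δ - q (-δ : ℝ) * e n (-δ))) := by
    rw [← hparts]; field_simp; ring
  rw [hdec, hfin]; ring

theorem laplaceIntegral_isBigO (h : IsLaplacePhase w s ρ δ c) {G : ℂ → ℂ}
    (hG : DifferentiableOn ℂ G (Metric.ball 0 ρ)) :
    laplaceIntegral w δ G =O[atTop] laplaceScale 0 := by
  have hδ := h.delta_pos
  have hc := h.c_pos
  obtain ⟨M, hM⟩ := isCompact_uIcc.exists_bound_of_continuousOn (h.continuousOn_real hG)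
  have hM0 : 0 ≤ M := (norm_nonneg _).trans (hM δ Set.right_mem_uIcc)
  refine IsBigO.of_bound (M * √(2 * Real.pi / c)) (eventually_atTop.2 ⟨1, fun n hn => ?_⟩)
  have hn0 : (0 : ℝ) < n := by exact_mod_cast hn
  set b : ℝ := n * c / 2 with hb
  have hb0 : 0 < b := by positivity
  have hgi := integrable_exp_neg_mul_sq hb0
  calc ‖laplaceIntegral w δ G n‖
      ≤ ∫ θ in (-δ)..δ, M * Real.exp (-b * θ ^ 2) := by
        refine intervalIntegral.norm_integral_le_of_norm_le (by linarith)
          (Eventually.of_forall fun θ hθ => ?_) (hgi.const_mul M).intervalIntegrable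
        have hθ' : |θ| ≤ δ := abs_le.2 ⟨hθ.1.le, hθ.2⟩
        have hθu : θ ∈ Set.uIcc (-δ) δ := by
          rw [Set.uIcc_of_le (by linarith)]; exact ⟨hθ.1.le, hθ.2⟩
        rw [norm_mul, norm_exp]
        have h1 := mul_le_mul_of_nonneg_left (h.re_sq θ hθ') hn0.le
        refine mul_le_mul (hM θ hθu) (Real.exp_le_exp.2 ?_) (Real.exp_pos _).le hM0
        rw [hb]; linarith
    _ = M * ∫ θ in Set.Ioc (-δ) δ, Real.exp (-b * θ ^ 2) := by
        rw [intervalIntegral.integral_const_mul, intervalIntegral.integral_of_le (by linarith)]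
    _ ≤ M * ∫ θ, Real.exp (-b * θ ^ 2) := by
        refine mul_le_mul_of_nonneg_left (MeasureTheory.setIntegral_le_integral hgi
          (Eventually.of_forall fun θ => (Real.exp_pos _).le)) hM0
    _ = M * √(2 * Real.pi / c) * ‖laplaceScale 0 n‖ := by
        rw [integral_gaussian, laplaceScale, pow_zero, inv_one, mul_one,
          Real.norm_of_nonneg (by positivity), mul_assoc, ← div_eq_mul_inv,
          ← Real.sqrt_div (by positivity), hb]
        congr 2; field_simp

theorem natCast_inv_isBigO {u : ℕ → ℂ} {N : ℕ} (hu : u =O[atTop] laplaceScale N) :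
    (fun n : ℕ => (n : ℂ)⁻¹ * u n) =O[atTop] laplaceScale (N + 1) := by
  rw [laplaceScale_succ]
  refine IsBigO.mul (IsBigO.of_norm_eventuallyLE (Eventually.of_forall fun n => ?_)) hu
  beta_reduce
  rw [norm_inv, Complex.norm_natCast]

/-- Iterates the integration by parts: T sends an amplitude to the next one, and the k-th
coefficient is the leading coefficient for T^k G. The induction must vary G, since the remainder
after one step is 1/n times the integral for T G. -/
theorem exists_laplaceIntegral_expansion (h : IsLaplacePhase w s ρ δ c) {G : ℂ → ℂ}
    (hG : DifferentiableOn ℂ G (Metric.ball 0 ρ)) :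
    ∃ d : ℕ → ℂ, d 0 = G 0 / deriv w 0 * (√(2 * Real.pi) : ℝ) ∧ ∀ N,
      (fun n : ℕ => laplaceIntegral w δ G n
        - ((√(n : ℝ))⁻¹ : ℝ) * ∑ k ∈ Finset.range N, d k * ((n : ℂ) ^ k)⁻¹)
        =O[atTop] laplaceScale N := by
  choose! T hT hTO using fun (G : ℂ → ℂ) (hG : DifferentiableOn ℂ G (Metric.ball 0 ρ)) =>
    h.exists_laplaceIntegral_step hG
  refine ⟨fun k => (T^[k] G) 0 / deriv w 0 * (√(2 * Real.pi) : ℝ), rfl, fun N => ?_⟩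
  induction N generalizing G with
  | zero => simpa using h.laplaceIntegral_isBigO hG
  | succ N ih =>
    refine ((natCast_inv_isBigO (ih (hT G hG))).add (hTO G hG (N + 1))).congr_left fun n => ?_
    rw [Finset.sum_range_succ']
    simp only [Function.iterate_succ_apply, Function.iterate_zero, id_eq, pow_zero, inv_one,
      mul_one]
    have : ∑ k ∈ Finset.range N, (T^[k] (T G)) 0 / deriv w 0 * (√(2 * Real.pi) : ℝ)
          * ((n : ℂ) ^ (k + 1))⁻¹
        = (n : ℂ)⁻¹ * ∑ k ∈ Finset.range N, (T^[k] (T G)) 0 / deriv w 0 * (√(2 * Real.pi) : ℝ)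
          * ((n : ℂ) ^ k)⁻¹ := by
      rw [Finset.mul_sum]
      refine Finset.sum_congr rfl fun k _ => ?_
      rw [pow_succ, mul_inv]; ring
    rw [this]; ring

end IsLaplacePhase

/-! ### Construction of the phase and the global Laplace expansion. -/

open scoped Topology

theorem hasDerivAt_deriv_of_eventuallyEq_sq_mul {h k : ℂ → ℂ} (hk : AnalyticAt ℂ k 0)
    (hh : h =ᶠ[𝓝 0] fun θ => θ ^ 2 * k θ) : HasDerivAt (deriv h) (2 * k 0) 0 := by
  have h1 : deriv h =ᶠ[𝓝 0] fun θ => 2 * θ * k θ + θ ^ 2 * deriv k θ := by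
    refine hh.deriv.trans ?_
    filter_upwards [hk.eventually_analyticAt] with θ hθ
    have : HasDerivAt (fun θ => θ ^ 2 * k θ) _ θ :=
      ((hasDerivAt_id θ).pow 2).mul hθ.differentiableAt.hasDerivAt
    rw [this.deriv]; simp
  refine HasDerivAt.congr_of_eventuallyEq ?_ h1
  have d1 := ((hasDerivAt_id (0 : ℂ)).const_mul 2).mul hk.differentiableAt.hasDerivAt
  have d2 := ((hasDerivAt_id (0 : ℂ)).pow 2).mul hk.deriv.differentiableAt.hasDerivAt
  have d3 : HasDerivAt (fun θ => 2 * θ * k θ + θ ^ 2 * deriv k θ) _ 0 := d1.add d2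
  exact d3.congr_deriv (by simp)

/-- A holomorphic function with a nondegenerate real maximum of the modulus at the origin is
`exp (-w² / 2)` for a Laplace phase `w`. -/
theorem exists_isLaplacePhase {H : ℂ → ℂ} {ρ₀ v : ℝ} (hρ₀ : 0 < ρ₀) (hv : 0 < v)
    (hH : DifferentiableOn ℂ H (Metric.ball 0 ρ₀)) (hH0 : H 0 = 1) (hH1 : deriv H 0 = 0)
    (hH2 : deriv (deriv H) 0 = -(v : ℂ)) :
    ∃ (w s : ℂ → ℂ) (ρ δ c : ℝ), IsLaplacePhase w s ρ δ c ∧ ρ ≤ ρ₀ ∧ δ ≤ 1 ∧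
      deriv w 0 = (√v : ℝ) ∧ ∀ θ ∈ Metric.ball (0 : ℂ) ρ, H θ = Complex.exp (-(w θ ^ 2 / 2)) := by
  have hmem0 : Metric.ball (0 : ℂ) ρ₀ ∈ 𝓝 0 := Metric.ball_mem_nhds _ hρ₀
  have hHan : AnalyticAt ℂ H 0 := hH.analyticAt hmem0
  have hslit : ∀ᶠ θ in 𝓝 (0 : ℂ), H θ ∈ Complex.slitPlane :=
    hHan.continuousAt.eventually
      (Complex.isOpen_slitPlane.mem_nhds (by rw [hH0]; exact Complex.one_mem_slitPlane))
  obtain ⟨ρ₁, hρ₁, hb₁⟩ := Metric.eventually_nhds_iff_ball.1 (hslit.and hmem0)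
  have hmem1 : Metric.ball (0 : ℂ) ρ₁ ∈ 𝓝 0 := Metric.ball_mem_nhds _ hρ₁
  -- The logarithm of H vanishes to second order at 0, so it equals θ² k₀ with k₀(0) = -v/2; the
  -- phase is θ times a square root of -2 k₀.
  set h : ℂ → ℂ := fun θ => Complex.log (H θ) with hh
  have hhd : DifferentiableOn ℂ h (Metric.ball 0 ρ₁) :=
    (hH.mono fun θ hθ => (hb₁ θ hθ).2).clog fun θ hθ => (hb₁ θ hθ).1
  have hh0 : h 0 = 0 := by simp [hh, hH0]
  have hderiv : deriv h =ᶠ[𝓝 0] fun θ => deriv H θ / H θ := by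
    filter_upwards [hmem1, hHan.eventually_analyticAt] with θ hθ hθ'
    exact (hθ'.differentiableAt.hasDerivAt.clog (hb₁ θ hθ).1).deriv
  have hh1 : deriv h 0 = 0 := by simp [hderiv.self_of_nhds, hH1]
  have hh2 : HasDerivAt (deriv h) (-(v : ℂ)) 0 := by
    refine HasDerivAt.congr_of_eventuallyEq ?_ hderiv
    have : HasDerivAt (fun θ => deriv H θ / H θ) _ 0 :=
      hHan.deriv.differentiableAt.hasDerivAt.div hHan.differentiableAt.hasDerivAt
        (by rw [hH0]; exact one_ne_zero)
    exact this.congr_deriv (by rw [hH0, hH1, hH2]; simp)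
  have hd1 := (Complex.differentiableOn_dslope hmem1).2 hhd
  have hd2 := (Complex.differentiableOn_dslope hmem1).2 hd1
  set k₀ : ℂ → ℂ := dslope (dslope h 0) 0 with hk₀
  have hfac : ∀ θ, h θ = θ ^ 2 * k₀ θ := by
    intro θ
    have e1 := sub_smul_dslope h 0 θ
    have e2 := sub_smul_dslope (dslope h 0) 0 θ
    rw [dslope_same, hh1] at e2
    rw [hh0] at e1
    simp only [sub_zero, smul_eq_mul] at e1 e2
    rw [← e1, ← e2]; ring
  have hk0 : 2 * k₀ 0 = -(v : ℂ) :=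
    (hasDerivAt_deriv_of_eventuallyEq_sq_mul (hd2.analyticAt hmem1)
      (Eventually.of_forall hfac)).unique hh2
  set k : ℂ → ℂ := fun θ => -2 * k₀ θ with hk
  have hkd : DifferentiableOn ℂ k (Metric.ball 0 ρ₁) := hd2.const_mul _
  have hkv : k 0 = v := by simp only [hk]; linear_combination -hk0
  have hkc : ContinuousAt k 0 := (hkd.differentiableAt hmem1).continuousAt
  have hkre : ∀ᶠ θ in 𝓝 (0 : ℂ), v / 2 < (k θ).re := by
    refine (Complex.continuous_re.continuousAt.comp hkc).eventually (lt_mem_nhds ?_)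
    simp only [Function.comp, hkv, Complex.ofReal_re]; linarith
  obtain ⟨ρ₂, hρ₂, hb₂⟩ := Metric.eventually_nhds_iff_ball.1 (hkre.and hmem1)
  have hmem2 : Metric.ball (0 : ℂ) ρ₂ ∈ 𝓝 0 := Metric.ball_mem_nhds _ hρ₂
  have hkslit : ∀ θ ∈ Metric.ball (0 : ℂ) ρ₂, k θ ∈ Complex.slitPlane := fun θ hθ =>
    Or.inl (by have := (hb₂ θ hθ).1; linarith)
  -- A holomorphic square root of k, available because Re k > v/2 > 0 on this disc.
  set s : ℂ → ℂ := fun θ => Complex.exp (Complex.log (k θ) / 2) with hs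
  have hsd : DifferentiableOn ℂ s (Metric.ball 0 ρ₂) :=
    (((hkd.mono fun θ hθ => (hb₂ θ hθ).2).clog hkslit).div_const 2).cexp
  have hs0 : s 0 = (√v : ℝ) := by
    simp only [hs, hkv]
    rw [← Complex.ofReal_log hv.le, Real.sqrt_eq_rpow, Real.rpow_def_of_pos hv]
    push_cast; ring_nf
  have hssq : ∀ θ ∈ Metric.ball (0 : ℂ) ρ₂, s θ ^ 2 = k θ := by
    intro θ hθ
    simp only [hs]
    rw [← Complex.exp_nat_mul, Nat.cast_ofNat, mul_div_cancel₀ _ (two_ne_zero),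
      Complex.exp_log (Complex.slitPlane_ne_zero (hkslit θ hθ))]
  set w : ℂ → ℂ := fun θ => θ * s θ with hw
  have hwd : DifferentiableOn ℂ w (Metric.ball 0 ρ₂) := differentiableOn_id.mul hsd
  have hw0 : deriv w 0 = (√v : ℝ) := by
    have : HasDerivAt w _ 0 := (hasDerivAt_id (0 : ℂ)).mul (hsd.differentiableAt hmem2).hasDerivAt
    rw [← hs0, this.deriv]; simp
  have hsv : 0 < √v := Real.sqrt_pos.2 hv
  have hw0' : deriv w 0 ≠ 0 := by rw [hw0]; exact_mod_cast hsv.ne'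
  have hw'c : ContinuousAt (deriv w) 0 :=
    ((hwd.deriv Metric.isOpen_ball).differentiableAt hmem2).continuousAt
  have hsre : ∀ᶠ θ in 𝓝 (0 : ℂ), 0 < (s θ).re := by
    refine (Complex.continuous_re.continuousAt.comp
      (hsd.differentiableAt hmem2).continuousAt).eventually (lt_mem_nhds ?_)
    simpa only [Function.comp, hs0, Complex.ofReal_re] using hsv
  obtain ⟨ρ, hρ, hb⟩ := Metric.eventually_nhds_iff_ball.1
    ((hw'c.eventually_ne hw0').and (hsre.and hmem2))
  set ρ' := min ρ ρ₀ with hρ'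
  have hρ'0 : 0 < ρ' := lt_min hρ hρ₀
  have hsub : ∀ θ ∈ Metric.ball (0 : ℂ) ρ', θ ∈ Metric.ball (0 : ℂ) ρ := fun θ hθ =>
    Metric.ball_subset_ball (min_le_left _ _) hθ
  have hδ0 : 0 < min (ρ' / 2) 1 := lt_min (by linarith) one_pos
  have hδρ : min (ρ' / 2) 1 < ρ' := (min_le_left _ _).trans_lt (by linarith)
  have hreal : ∀ θ : ℝ, |θ| ≤ min (ρ' / 2) 1 → (θ : ℂ) ∈ Metric.ball (0 : ℂ) ρ := fun θ hθ => by
    refine hsub _ ?_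
    rw [mem_ball_zero_iff, Complex.norm_real, Real.norm_eq_abs]
    exact hθ.trans_lt hδρ
  -- The constant v/2 is the lower bound for Re k, as w² = θ² k. The cap δ ≤ 1 later places [-δ, δ]
  -- inside [-L, L].
  refine ⟨w, s, ρ', min (ρ' / 2) 1, v / 2, ⟨hδ0, hδρ, by linarith, fun θ => rfl, ?_, ?_, ?_, ?_,
    ?_, ?_⟩, min_le_right _ _, min_le_right _ _, hw0, ?_⟩
  · exact hsd.mono fun θ hθ => (hb θ (hsub θ hθ)).2.2
  · exact fun θ _ => Complex.exp_ne_zero _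
  · exact fun θ hθ => (hb θ (hsub θ hθ)).1
  · intro θ hθ
    have h2 := (hb _ (hreal θ hθ)).2.2
    simp only [hw]
    rw [mul_pow, hssq _ h2, ← Complex.ofReal_pow, Complex.re_ofReal_mul, mul_comm]
    exact mul_le_mul_of_nonneg_left (hb₂ _ h2).1.le (sq_nonneg θ)
  · have := (hb _ (hreal (min (ρ' / 2) 1) (abs_of_pos hδ0).le)).2.1
    simp only [hw]
    rw [Complex.re_ofReal_mul]
    exact mul_pos hδ0 this
  · have := (hb _ (hreal (-min (ρ' / 2) 1) (by rw [abs_neg, abs_of_pos hδ0]))).2.1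
    simp only [hw]
    rw [Complex.re_ofReal_mul]
    exact mul_neg_of_neg_of_pos (neg_lt_zero.2 hδ0) this
  · intro θ hθ
    have h2 := (hb _ (hsub θ hθ)).2.2
    have h1 := (hb₂ _ h2).2
    have : -(w θ ^ 2 / 2) = h θ := by
      simp only [hw]; rw [mul_pow, hssq _ h2, hfac]; simp only [hk]; ring
    rw [this, hh, Complex.exp_log (Complex.slitPlane_ne_zero (hb₁ θ h1).1)]

/-- By compactness |H| stays below a constant less than 1, so the integral decays exponentially. -/
theorem integral_mul_pow_isBigO {G H : ℝ → ℂ} {a b : ℝ} (hab : a ≤ b)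
    (hG : ContinuousOn G (Set.Icc a b)) (hH : ContinuousOn H (Set.Icc a b))
    (hlt : ∀ θ ∈ Set.Icc a b, ‖H θ‖ < 1) (N : ℕ) :
    (fun n : ℕ => ∫ θ in a..b, G θ * H θ ^ n) =O[atTop] laplaceScale N := by
  obtain ⟨M, hM⟩ := isCompact_Icc.exists_bound_of_continuousOn hG
  have hM0 : 0 ≤ M := (norm_nonneg _).trans (hM a (Set.left_mem_Icc.2 hab))
  obtain ⟨θ₀, hθ₀, hmax⟩ := isCompact_Icc.exists_isMaxOn (Set.nonempty_Icc.2 hab) hH.norm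
  refine IsBigO.trans (IsBigO.of_bound (M * |b - a|) (Eventually.of_forall fun n => ?_))
    (isBigO_pow_laplaceScale (norm_nonneg (H θ₀)) (hlt θ₀ hθ₀) N)
  rw [norm_pow, norm_norm]
  have := intervalIntegral.norm_integral_le_of_norm_le_const (a := a) (b := b)
    (f := fun θ => G θ * H θ ^ n) (C := M * ‖H θ₀‖ ^ n) (fun θ hθ => ?_)
  · linarith
  · rw [Set.uIoc_of_le hab] at hθ
    have hθ' := Set.Ioc_subset_Icc_self hθ
    rw [norm_mul, norm_pow]
    exact mul_le_mul (hM θ hθ') (pow_le_pow_left₀ (norm_nonneg _) (hmax hθ') n) (by positivity) hM0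

/-- **Laplace's method** with a complete asymptotic expansion, for a complex amplitude and phase. -/
theorem exists_integral_mul_pow_expansion {G H : ℂ → ℂ} {ρ₀ v L : ℝ} (hρ₀ : 0 < ρ₀) (hv : 0 < v)
    (hL : 1 ≤ L) (hG : DifferentiableOn ℂ G (Metric.ball 0 ρ₀))
    (hH : DifferentiableOn ℂ H (Metric.ball 0 ρ₀)) (hH0 : H 0 = 1) (hH1 : deriv H 0 = 0)
    (hH2 : deriv (deriv H) 0 = -(v : ℂ)) (hGc : Continuous fun θ : ℝ => G θ)
    (hHc : Continuous fun θ : ℝ => H θ) (hlt : ∀ θ : ℝ, |θ| ≤ L → θ ≠ 0 → ‖H θ‖ < 1) :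
    ∃ d : ℕ → ℂ, d 0 = G 0 / (√v : ℝ) * (√(2 * Real.pi) : ℝ) ∧ ∀ N,
      (fun n : ℕ => (∫ θ in (-L)..L, G (θ : ℂ) * H θ ^ n)
        - ((√(n : ℝ))⁻¹ : ℝ) * ∑ k ∈ Finset.range N, d k * ((n : ℂ) ^ k)⁻¹)
        =O[atTop] laplaceScale N := by
  obtain ⟨w, s, ρ, δ, c, hp, hρ, hδ1, hw0, hexp⟩ :=
    exists_isLaplacePhase hρ₀ hv hH hH0 hH1 hH2
  have hδ := hp.delta_pos
  obtain ⟨d, hd0, hd⟩ :=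
    hp.exists_laplaceIntegral_expansion (hG.mono (Metric.ball_subset_ball hρ))
  refine ⟨d, by rw [hd0, hw0], fun N => ?_⟩
  have t1 := integral_mul_pow_isBigO (by linarith : -L ≤ -δ) hGc.continuousOn hHc.continuousOn
    (fun θ hθ => hlt θ (abs_le.2 ⟨hθ.1, by linarith [hθ.2]⟩) (by linarith [hθ.2])) N
  have t2 := integral_mul_pow_isBigO (by linarith : δ ≤ L) hGc.continuousOn hHc.continuousOn
    (fun θ hθ => hlt θ (abs_le.2 ⟨by linarith [hθ.1], hθ.2⟩) (by linarith [hθ.1])) N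
  refine ((hd N).add (t1.add t2)).congr_left fun n => ?_
  have hc : Continuous fun θ : ℝ => G (θ : ℂ) * H θ ^ n := hGc.mul (hHc.pow n)
  have hi : ∀ a b : ℝ, IntervalIntegrable (fun θ : ℝ => G (θ : ℂ) * H θ ^ n)
      MeasureTheory.volume a b := fun a b => hc.intervalIntegrable a b
  have hmid : laplaceIntegral w δ G n = ∫ θ in (-δ)..δ, G (θ : ℂ) * H θ ^ n := by
    refine intervalIntegral.integral_congr fun θ hθ => ?_
    rw [hexp θ (hp.mem_ball hθ), ← Complex.exp_nat_mul]
    congr 2; ring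
  rw [← intervalIntegral.integral_add_adjacent_intervals (hi (-L) (-δ)) (hi (-δ) L),
    ← intervalIntegral.integral_add_adjacent_intervals (hi (-δ) δ) (hi δ L), hmid]
  ring

end Laplace

/-! ### The saddle point integrand and its link with the coefficients. -/

section TreeSeries

open scoped Topology

theorem derivative_map_algebraMap (φ : PowerSeries ℝ) :
    derivative ℂ (φ.map (algebraMap ℝ ℂ)) = (derivative ℝ φ).map (algebraMap ℝ ℂ) := by
  ext n; simp [coeff_derivative]

theorem map_eq_X_mul_subst {φ f : PowerSeries ℝ} (hf : f = X * φ.subst f) :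
    f.map (algebraMap ℝ ℂ)
      = X * (φ.map (algebraMap ℝ ℂ)).subst (f.map (algebraMap ℝ ℂ)) := by
  have hs : HasSubst f := HasSubst.of_constantCoeff_zero' (by rw [hf]; simp)
  have h1 := map_subst hs (h := algebraMap ℝ ℂ) φ
  conv_lhs => rw [hf]
  rw [map_mul, PowerSeries.map_X]
  congr 1

theorem norm_mul_exp_I (y : ℝ) (hy : 0 ≤ y) (θ : ℝ) :
    ‖(y : ℂ) * Complex.exp (θ * Complex.I)‖ = y := by
  rw [norm_mul, Complex.norm_exp_ofReal_mul_I, mul_one, Complex.norm_real,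
    Real.norm_of_nonneg hy]

/-- The normalised integrand of the saddle point method on the circle of radius `y`. -/
noncomputable def saddleFun (φ : PowerSeries ℝ) (y : ℝ) (θ : ℂ) : ℂ :=
  seriesFun (φ.map (algebraMap ℝ ℂ)) (y * Complex.exp (θ * Complex.I))
    * Complex.exp (-(θ * Complex.I)) / (seriesFun φ y : ℝ)

theorem hasDerivAt_seriesFun_circle {p : PowerSeries ℂ} {y R : ℝ} (hp : AbsSummableAt p R) {θ : ℂ}
    (hθ : ‖(y : ℂ) * Complex.exp (θ * Complex.I)‖ < R) :
    HasDerivAt (fun θ : ℂ => seriesFun p (y * Complex.exp (θ * Complex.I)))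
      (seriesFun (derivative ℂ p) (y * Complex.exp (θ * Complex.I))
        * (y * Complex.exp (θ * Complex.I) * Complex.I)) θ := by
  have h1 : HasDerivAt (fun θ : ℂ => (y : ℂ) * Complex.exp (θ * Complex.I))
      (y * (Complex.exp (θ * Complex.I) * (1 * Complex.I))) θ :=
    (((hasDerivAt_id θ).mul_const Complex.I).cexp).const_mul _
  exact (HasDerivAt.comp θ (hp.hasDerivAt hθ) h1).congr_deriv (by ring)

theorem hasDerivAt_saddleFun {φ : PowerSeries ℝ} {y R : ℝ} (hp : AbsSummableAt φ R) {θ : ℂ}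
    (hθ : ‖(y : ℂ) * Complex.exp (θ * Complex.I)‖ < R) :
    HasDerivAt (saddleFun φ y)
      ((seriesFun ((derivative ℝ φ).map (algebraMap ℝ ℂ)) (y * Complex.exp (θ * Complex.I))
          * (y * Complex.exp (θ * Complex.I))
        - seriesFun (φ.map (algebraMap ℝ ℂ)) (y * Complex.exp (θ * Complex.I)))
        * (Complex.I * Complex.exp (-(θ * Complex.I)) / (seriesFun φ y : ℝ))) θ := by
  have h1 := hasDerivAt_seriesFun_circle hp.map hθ
  have h2 : HasDerivAt (fun θ : ℂ => Complex.exp (-(θ * Complex.I)))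
      (Complex.exp (-(θ * Complex.I)) * -(1 * Complex.I)) θ :=
    ((hasDerivAt_id θ).mul_const Complex.I).neg.cexp
  refine ((h1.mul h2).div_const _).congr_deriv ?_
  rw [derivative_map_algebraMap]; ring

theorem eventually_norm_circle_lt {y R : ℝ} (hy : 0 ≤ y) (hyR : y < R) :
    ∀ᶠ θ in 𝓝 (0 : ℂ), ‖(y : ℂ) * Complex.exp (θ * Complex.I)‖ < R := by
  have hc : Continuous fun θ : ℂ => ‖(y : ℂ) * Complex.exp (θ * Complex.I)‖ := by fun_prop
  refine hc.continuousAt.eventually (gt_mem_nhds ?_)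
  simpa [abs_of_nonneg hy] using hyR

theorem saddleFun_zero {φ : PowerSeries ℝ} {y : ℝ} (h : seriesFun φ y ≠ 0) :
    saddleFun φ y 0 = 1 := by
  simp [saddleFun, seriesFun_map_ofReal, h]

/-- The derivative at 0 is a multiple of y φ'(y) - φ(y), which the saddle equation annihilates. -/
theorem deriv_saddleFun_zero {φ : PowerSeries ℝ} {y R : ℝ} (hy : 0 ≤ y) (hyR : y < R)
    (hp : AbsSummableAt φ R) (hsad : y * seriesFun (derivative ℝ φ) y = seriesFun φ y) :
    deriv (saddleFun φ y) 0 = 0 := by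
  rw [(hasDerivAt_saddleFun hp (eventually_norm_circle_lt hy hyR).self_of_nhds).deriv]
  simp only [zero_mul, Complex.exp_zero, mul_one, seriesFun_map_ofReal, ← hsad]
  push_cast; ring

/-- The first derivative is u φ'(u) - φ(u) at u = y e^{iθ}, times a smooth factor. The former
vanishes at θ = 0, so only its own derivative i u² φ''(u) survives there, multiplied by i/φ(y). -/
theorem deriv_deriv_saddleFun_zero {φ : PowerSeries ℝ} {y R : ℝ} (hy : 0 ≤ y) (hyR : y < R)
    (hp : AbsSummableAt φ R) (hsad : y * seriesFun (derivative ℝ φ) y = seriesFun φ y) :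
    deriv (deriv (saddleFun φ y)) 0
      = -((y ^ 2 * seriesFun (derivative ℝ (derivative ℝ φ)) y / seriesFun φ y : ℝ) : ℂ) := by
  obtain ⟨r, hyr, hrR⟩ := exists_between hyR
  have hp1 := hp.derivative (hy.trans hyr.le) hrR
  have he : deriv (saddleFun φ y) =ᶠ[𝓝 0] fun θ =>
      ((seriesFun ((derivative ℝ φ).map (algebraMap ℝ ℂ)) (y * Complex.exp (θ * Complex.I))
          * (y * Complex.exp (θ * Complex.I))
        - seriesFun (φ.map (algebraMap ℝ ℂ)) (y * Complex.exp (θ * Complex.I)))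
        * (Complex.I * Complex.exp (-(θ * Complex.I)) / (seriesFun φ y : ℝ))) := by
    filter_upwards [eventually_norm_circle_lt hy hyR] with θ hθ
    exact (hasDerivAt_saddleFun hp hθ).deriv
  rw [he.deriv_eq]
  have h0 := hasDerivAt_seriesFun_circle hp.map (eventually_norm_circle_lt hy hyR).self_of_nhds
  have h1 := hasDerivAt_seriesFun_circle hp1.map (eventually_norm_circle_lt hy hyr).self_of_nhds
  have h2 : HasDerivAt (fun θ : ℂ => (y : ℂ) * Complex.exp (θ * Complex.I))
      (y * (Complex.exp (0 * Complex.I) * (1 * Complex.I))) 0 :=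
    (((hasDerivAt_id (0 : ℂ)).mul_const Complex.I).cexp).const_mul _
  have h3 : DifferentiableAt ℂ (fun θ : ℂ =>
      Complex.I * Complex.exp (-(θ * Complex.I)) / (seriesFun φ y : ℝ)) 0 := by fun_prop
  have h4 : HasDerivAt (fun θ =>
      ((seriesFun ((derivative ℝ φ).map (algebraMap ℝ ℂ)) (y * Complex.exp (θ * Complex.I))
          * (y * Complex.exp (θ * Complex.I))
        - seriesFun (φ.map (algebraMap ℝ ℂ)) (y * Complex.exp (θ * Complex.I)))
        * (Complex.I * Complex.exp (-(θ * Complex.I)) / (seriesFun φ y : ℝ)))) _ 0 :=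
    ((h1.mul h2).sub h0).mul h3.hasDerivAt
  rw [h4.deriv, derivative_map_algebraMap, derivative_map_algebraMap]
  simp only [zero_mul, Complex.exp_zero, mul_one, neg_zero, seriesFun_map_ofReal, Pi.mul_apply,
    Pi.sub_apply]
  have hsadC : (y : ℂ) * (seriesFun (derivative ℝ φ) y : ℝ) = (seriesFun φ y : ℝ) := by
    exact_mod_cast hsad
  have hz : ((seriesFun (derivative ℝ φ) y : ℝ) : ℂ) * y - (seriesFun φ y : ℝ) = 0 := by
    rw [← hsadC]; ring
  rw [hz, zero_mul, add_zero]
  push_cast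
  linear_combination
    ((y : ℂ) ^ 2 * (seriesFun (derivative ℝ (derivative ℝ φ)) y : ℝ) / (seriesFun φ y : ℝ))
      * Complex.I_sq

theorem integral_saddle_eq_coeff {φ : PowerSeries ℝ} {ψ : PowerSeries ℂ} {f : PowerSeries ℝ}
    {y : ℝ} (hy : 0 < y) (hφ0 : coeff 0 φ ≠ 0) (hf : f = X * φ.subst f)
    (hφ : AbsSummableAt φ y) (hψ : AbsSummableAt (derivative ℂ ψ) y) {n : ℕ} (hn : 1 ≤ n) :
    ∫ θ in (-Real.pi)..Real.pi, (y * Complex.exp (θ * Complex.I)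
        * seriesFun (derivative ℂ ψ) (y * Complex.exp (θ * Complex.I))) * saddleFun φ y θ ^ n
      = 2 * Real.pi * (n * (y / (seriesFun φ y : ℝ)) ^ n
        * coeff n (ψ.subst (f.map (algebraMap ℝ ℂ)))) := by
  obtain ⟨m, rfl⟩ : ∃ m, n = m + 1 := ⟨n - 1, by omega⟩
  set Φ := φ.map (algebraMap ℝ ℂ) with hΦ
  have hΦ0 : constantCoeff Φ ≠ 0 := by
    rw [← coeff_zero_eq_constantCoeff_apply, hΦ, coeff_map]
    simpa using hφ0
  have hlag := lagrange_inversion hΦ0 (map_eq_X_mul_subst hf) ψ m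
  have hΦs : AbsSummableAt (Φ ^ (m + 1)) y := hφ.map.pow hy.le _
  have hint := (hψ.mul hy.le hΦs).integral_seriesFun hy.le m
  have hpt : ∀ θ : ℝ, (y * Complex.exp (θ * Complex.I)
        * seriesFun (derivative ℂ ψ) (y * Complex.exp (θ * Complex.I)))
          * saddleFun φ y θ ^ (m + 1)
      = y / (seriesFun φ y : ℝ) ^ (m + 1)
        * (seriesFun (derivative ℂ ψ * Φ ^ (m + 1)) (y * Complex.exp (θ * Complex.I))
          * Complex.exp (-(m * θ * Complex.I))) := by
    intro θ
    have hn := (norm_mul_exp_I y hy.le θ).le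
    -- The extra e^{iθ} in the amplitude lowers the frequency from m + 1 to m, the index required by
    -- Lagrange inversion.
    have he : Complex.exp (θ * Complex.I) * Complex.exp (-(θ * Complex.I)) ^ (m + 1)
        = Complex.exp (-(m * θ * Complex.I)) := by
      rw [← Complex.exp_nat_mul, ← Complex.exp_add]; congr 1; push_cast; ring
    rw [hψ.seriesFun_mul hΦs hn, hφ.map.seriesFun_pow hn, ← he, saddleFun, div_pow, mul_pow]
    ring
  rw [intervalIntegral.integral_congr (fun θ _ => hpt θ), intervalIntegral.integral_const_mul,
    hint, ← hlag]
  push_cast; rw [div_pow]; ring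

theorem deriv_seriesFun {𝕜 : Type*} [RCLike 𝕜] {p : PowerSeries 𝕜} {R : ℝ} {x : 𝕜}
    (h : AbsSummableAt p R) (hx : ‖x‖ < R) :
    deriv (seriesFun p) x = seriesFun (derivative 𝕜 p) x :=
  (h.hasDerivAt hx).deriv

theorem deriv_deriv_seriesFun {𝕜 : Type*} [RCLike 𝕜] {p : PowerSeries 𝕜} {R : ℝ} {x : 𝕜}
    (h : AbsSummableAt p R) (hx : ‖x‖ < R) :
    deriv (deriv (seriesFun p)) x = seriesFun (derivative 𝕜 (derivative 𝕜 p)) x := by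
  obtain ⟨r, hxr, hrR⟩ := exists_between hx
  have he : deriv (seriesFun p) =ᶠ[𝓝 x] seriesFun (derivative 𝕜 p) := by
    filter_upwards [continuous_norm.continuousAt.eventually (gt_mem_nhds hx)] with z hz
    exact deriv_seriesFun h hz
  rw [he.deriv_eq]
  exact deriv_seriesFun (h.derivative ((norm_nonneg x).trans hxr.le) hrR) hxr

end TreeSeries

/-! ### The main theorem. -/

theorem mainTheorem11
    (φ : PowerSeries ℝ)
    (hφ_an : 0 < seriesRadius φ)
    (hφ_zero : coeff 0 φ ≠ 0)
    (hφ_nonneg : ∀ k : ℕ, 0 ≤ coeff k φ)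
    (hφ_aper : IsAperiodicSeries φ)
    (hφ_deg : ∃ k : ℕ, 2 ≤ k ∧ coeff k φ ≠ 0)
    (f : PowerSeries ℝ)
    (hf : f = X * φ.subst f)
    (y₀ : ℝ)
    (hy₀_pos : 0 < y₀)
    (hy₀_lt : ENNReal.ofReal y₀ < seriesRadius φ)
    (hy₀ : y₀ * deriv (seriesFun φ) y₀ = seriesFun φ y₀)
    (ψ : PowerSeries ℂ)
    (hψ : ENNReal.ofReal y₀ < seriesRadius ψ) :
    ∃ b : ℕ → ℂ,
      b 0 = deriv (seriesFun ψ) (y₀ : ℂ) /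
          ((Real.sqrt (2 * Real.pi * deriv (deriv (seriesFun φ)) y₀ / seriesFun φ y₀) : ℝ) : ℂ) ∧
      HasAsymptoticSeries
        (fun n : ℕ => coeff n (ψ.subst (f.map (algebraMap ℝ ℂ))))
        (fun n : ℕ => deriv (seriesFun φ) y₀ ^ n * (n : ℝ) ^ (-(3 / 2) : ℝ))
        b := by
  obtain ⟨R₁, hR₁, hφ₁⟩ := exists_absSummableAt_of_lt_seriesRadius hy₀_pos.le hy₀_lt
  obtain ⟨R₂, hR₂, hψ₂⟩ := exists_absSummableAt_of_lt_seriesRadius hy₀_pos.le hψ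
  -- A radius strictly between y₀ and both R₁ and R₂ leaves room for φ' and ψ' to converge
  -- absolutely at R.
  obtain ⟨R, hyR, hRR⟩ := exists_between (lt_min hR₁ hR₂)
  have hR0 : 0 ≤ R := hy₀_pos.le.trans hyR.le
  have hR1 : R < R₁ := hRR.trans_le (min_le_left _ _)
  have hφR : AbsSummableAt φ R := hφ₁.mono hR0 hR1.le
  have hφ1R : AbsSummableAt (derivative ℝ φ) R := hφ₁.derivative hR0 hR1
  have hψ1R : AbsSummableAt (derivative ℂ ψ) R :=
    hψ₂.derivative hR0 (hRR.trans_le (min_le_right _ _))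
  have hny : ‖y₀‖ < R := by rwa [Real.norm_of_nonneg hy₀_pos.le]
  have hnyC : ‖(y₀ : ℂ)‖ < R₂ := by
    rw [Complex.norm_real, Real.norm_of_nonneg hy₀_pos.le]; exact hR₂
  rw [deriv_seriesFun hφR hny] at hy₀
  rw [deriv_deriv_seriesFun hφR hny, deriv_seriesFun hφR hny, deriv_seriesFun hψ₂ hnyC]
  set F : ℝ := seriesFun φ y₀ with hF
  set F₁ : ℝ := seriesFun (derivative ℝ φ) y₀ with hF₁
  set F₂ : ℝ := seriesFun (derivative ℝ (derivative ℝ φ)) y₀ with hF₂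
  have hφy := hφR.mono hy₀_pos.le hyR.le
  have hFpos : 0 < F := seriesFun_pos hy₀_pos hφ_nonneg hφy hφ_zero
  have hF₂pos : 0 < F₂ := by
    obtain ⟨k, hk2, hk⟩ := hφ_deg
    obtain ⟨j, rfl⟩ : ∃ j, k = j + 1 + 1 := ⟨k - 2, by omega⟩
    obtain ⟨r, hyr, hrR⟩ := exists_between hyR
    refine seriesFun_pos (k := j) hy₀_pos (fun i => ?_) (hφ1R.derivative hy₀_pos.le hyR) ?_
    · rw [coeff_derivative, coeff_derivative]
      have := hφ_nonneg (i + 1 + 1)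
      positivity
    · rw [coeff_derivative, coeff_derivative]
      have h1 : (j : ℝ) + 1 ≠ 0 := by positivity
      have h2 : ((j + 1 : ℕ) : ℝ) + 1 ≠ 0 := by positivity
      exact mul_ne_zero (mul_ne_zero hk h2) h1
  have hF₁eq : F₁ = F / y₀ := by rw [← hy₀]; field_simp
  set v : ℝ := y₀ ^ 2 * F₂ / F with hv
  have hvpos : 0 < v := by positivity
  set G : ℂ → ℂ := fun θ => y₀ * Complex.exp (θ * Complex.I)
    * seriesFun (derivative ℂ ψ) (y₀ * Complex.exp (θ * Complex.I)) with hG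
  obtain ⟨ρ, hρ, hb⟩ := Metric.eventually_nhds_iff_ball.1
    (eventually_norm_circle_lt hy₀_pos.le hyR)
  have hGd : ∀ θ : ℂ, ‖(y₀ : ℂ) * Complex.exp (θ * Complex.I)‖ < R → DifferentiableAt ℂ G θ := by
    intro θ hθ
    exact DifferentiableAt.mul (by fun_prop)
      (hasDerivAt_seriesFun_circle hψ1R hθ).differentiableAt
  have hHd : ∀ θ : ℂ, ‖(y₀ : ℂ) * Complex.exp (θ * Complex.I)‖ < R →
      DifferentiableAt ℂ (saddleFun φ y₀) θ := fun θ hθ =>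
    (hasDerivAt_saddleFun hφR hθ).differentiableAt
  have hreal : ∀ θ : ℝ, ‖(y₀ : ℂ) * Complex.exp (θ * Complex.I)‖ < R := fun θ => by
    rw [norm_mul_exp_I y₀ hy₀_pos.le]; exact hyR
  obtain ⟨d, hd0, hd⟩ := exists_integral_mul_pow_expansion (G := G) (H := saddleFun φ y₀)
    (L := Real.pi) hρ hvpos (by linarith [Real.pi_gt_three])
    (fun θ hθ => (hGd θ (hb θ hθ)).differentiableWithinAt)
    (fun θ hθ => (hHd θ (hb θ hθ)).differentiableWithinAt)
    (saddleFun_zero hFpos.ne') (deriv_saddleFun_zero hy₀_pos.le hyR hφR hy₀)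
    (deriv_deriv_saddleFun_zero hy₀_pos.le hyR hφR hy₀)
    (continuous_iff_continuousAt.2 fun θ =>
      (hGd θ (hreal θ)).continuousAt.comp Complex.continuous_ofReal.continuousAt)
    (continuous_iff_continuousAt.2 fun θ =>
      (hHd θ (hreal θ)).continuousAt.comp Complex.continuous_ofReal.continuousAt)
    (fun θ hθ hθ0 => by
      have hlt := hφ_aper.norm_seriesFun_exp_lt hy₀_pos hφ_nonneg hφy hφ_zero hθ hθ0
      have hexp : ‖Complex.exp (-(θ * Complex.I))‖ = 1 := by
        rw [← neg_mul, ← Complex.ofReal_neg, Complex.norm_exp_ofReal_mul_I]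
      rw [saddleFun, norm_div, norm_mul, hexp, mul_one, Complex.norm_real,
        Real.norm_of_nonneg hFpos.le, div_lt_one hFpos]
      exact hlt)
  have h2pi : (0 : ℝ) < 2 * Real.pi := by positivity
  -- The division by 2π comes from Cauchy's formula. In b₀ it combines with the Gaussian √(2π) to
  -- 1/√(2π), and the y₀ in G(0) cancels the y₀ in √v.
  refine ⟨fun k => d k / (2 * Real.pi : ℝ), ?_, fun N => ?_⟩
  · have hsv : √v = y₀ * √(F₂ / F) := by
      rw [hv, mul_div_assoc, Real.sqrt_mul (by positivity), Real.sqrt_sq hy₀_pos.le]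
    have hsR : √(2 * Real.pi * F₂ / F) = √(2 * Real.pi) * √(F₂ / F) := by
      rw [mul_div_assoc, Real.sqrt_mul h2pi.le]
    have hG0 : G 0 = y₀ * seriesFun (derivative ℂ ψ) y₀ := by simp [hG]
    have h2 : ((2 * Real.pi : ℝ) : ℂ) = (√(2 * Real.pi) : ℝ) * (√(2 * Real.pi) : ℝ) := by
      rw [← Complex.ofReal_mul, Real.mul_self_sqrt h2pi.le]
    have hne1 : ((√(2 * Real.pi) : ℝ) : ℂ) ≠ 0 := by
      exact_mod_cast (Real.sqrt_pos.2 h2pi).ne'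
    have hne2 : ((√(F₂ / F) : ℝ) : ℂ) ≠ 0 := by
      exact_mod_cast (Real.sqrt_pos.2 (div_pos hF₂pos hFpos)).ne'
    have hne3 : (y₀ : ℂ) ≠ 0 := by exact_mod_cast hy₀_pos.ne'
    simp only []
    rw [hd0, hG0, hsR, hsv, h2, Complex.ofReal_mul, Complex.ofReal_mul]
    field_simp
  · have hpre : (fun n : ℕ => ((F₁ ^ n * (n : ℝ)⁻¹ : ℝ) : ℂ) / (2 * Real.pi : ℝ))
        =O[atTop] fun n : ℕ => F₁ ^ n * (n : ℝ)⁻¹ := by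
      refine IsBigO.of_bound ‖((2 * Real.pi : ℝ) : ℂ)‖⁻¹ (Eventually.of_forall fun n => ?_)
      rw [norm_div, Complex.norm_real, div_eq_inv_mul]
    have hscale : ∀ n : ℕ, 1 ≤ n → (n : ℝ) ^ (-(3 / 2) : ℝ) = (n : ℝ)⁻¹ * (√(n : ℝ))⁻¹ := by
      intro n hn
      have hn0 : (0 : ℝ) < n := by exact_mod_cast hn
      rw [Real.sqrt_eq_rpow, ← Real.rpow_neg hn0.le, ← Real.rpow_neg_one, ← Real.rpow_add hn0]
      norm_num
    -- Multiplying the expansion of the integral by F₁ⁿ / (2πn) undoes the normalisation (y₀/F)ⁿ,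
    -- since F₁ = F/y₀. The identities need n ≥ 1.
    refine (hpre.mul (hd N)).congr' ?_ ?_
    · filter_upwards [eventually_ge_atTop 1] with n hn
      have hn0 : (n : ℂ) ≠ 0 := by exact_mod_cast (by omega : n ≠ 0)
      have hI := integral_saddle_eq_coeff hy₀_pos hφ_zero hf hφy
        (hψ1R.mono hy₀_pos.le hyR.le) hn
      simp only [hG]
      rw [hI, hscale n hn, hF₁eq]
      have hne4 : (F : ℂ) ≠ 0 := by exact_mod_cast hFpos.ne'
      have hne3 : (y₀ : ℂ) ≠ 0 := by exact_mod_cast hy₀_pos.ne'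
      have hsum : ∑ k ∈ Finset.range N, d k / (2 * Real.pi : ℝ) * ((n : ℂ) ^ k)⁻¹
          = (∑ k ∈ Finset.range N, d k * ((n : ℂ) ^ k)⁻¹) / (2 * Real.pi : ℝ) := by
        rw [Finset.sum_div]
        exact Finset.sum_congr rfl fun k _ => by ring
      have hcancel : ((F : ℂ) / y₀) ^ n * (y₀ / F) ^ n = 1 := by
        rw [← mul_pow, div_mul_div_comm, mul_comm, div_self (by positivity), one_pow]
      rw [hsum]
      push_cast
      rw [mul_sub]
      congr 1
      · calc _ = (((F : ℂ) / y₀) ^ n * (y₀ / F) ^ n) * ((n : ℂ)⁻¹ * n)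
              * (2 * Real.pi / (2 * Real.pi))
              * coeff n (ψ.subst (f.map (algebraMap ℝ ℂ))) := by ring
          _ = _ := by
            rw [hcancel, inv_mul_cancel₀ hn0, div_self (by simp)]; ring
      · ring
    · filter_upwards [eventually_ge_atTop 1] with n hn
      rw [hscale n hn, laplaceScale]; ring
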